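/- **Definitions.** A *graphex* $\mathbb W=(W,S,I,\mathbf\Omega)$ consists of a $\sigma$-finite measure space $\mathbf\Omega=(\Omega,\mathcal F,\mu)$, a symmetric measurable $W:\Omega\times\Omega\to[0,1]$, a measurable $S:\Omega\to[0,\infty)$ and a real $I\ge 0$ such that $W(\cdot,x)$ is $\mu$-integrable for almost every $x$, and there is a measurable $\Omega'\subseteq\Omega$ with $\mu(\Omega\setminus\Omega')<\infty$ and $\int_{\Omega'\times\Omega'}W\,d\mu\,d\mu+2\int_{\Omega'}S\,d\mu+2I<\infty$. Its marginal is $D_{\mathbb W}(x)=\int_\Omega W(x,y)\,d\mu(y)+S(x)$, and its edge density is $\rho(\mathbb W)=\int W\,d\mu\,d\mu+2\int S\,d\mu+2I$. We say $\mathbb W\in L^1\cap L^2$ if both $W$ and $D_{\mathbb W}$ are in $L^1\cap L^2$. For a measurable map $\varphi$ from a measure space $(\Omega',\mu')$ to $\Omega$, put $W^\varphi(x,y)=W(\varphi(x),\varphi(y))$, $S^\varphi=S\circ\varphi$ and $\mathbb W^{\varphi,\mu'}=(W^\varphi,S^\varphi,I,(\Omega',\mu'))$. A *coupling* of $\mu_1$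 and $\mu_2$ is a measure on $\Omega_1\times\Omega_2$ with marginals $\mu_1$ and $\mu_2$; $\pi_i:\Omega_1\times\Omega_2\to\Omega_i$ denotes the projection. For $\mathbb W_1,\mathbb W_2\in L^1\cap L^2$ over the same measure space let $$d_{2\to2}(\mathbb W_1,\mathbb W_2)=\max\Bigl(\|W_1-W_2\|_{2\to2},\ \sqrt{\|D_{\mathbb W_1}-D_{\mathbb W_2}\|_2},\ \sqrt[3]{|\rho(\mathbb W_1)-\rho(\mathbb W_2)|}\Bigr),$$ where $\|U\|_{2\to2}=\sup_{\|f\|_2=\|g\|_2=1}\int f(x)U(x,y)g(y)\,d\mu(x)\,d\mu(y)$. For $\mathbb W_1,\mathbb W_2\in L^1\cap L^2$ over arbitrary $\sigma$-finite spaces let $$\delta_{2\to2}(\mathbb W_1,\mathbb W_2)=\inf_{\nu}\, d_{2\to2}\bigl((\mathbb W_1')^{\pi_1,\nu},(\mathbb W_2')^{\pi_2,\nu}\bigr),$$ where $\mathbb W_i'$ is the trivial extension of $\mathbb W_i$ (by $W=0$, $S=0$, with the same $I$) to the space of infinite total measure obtained from $\mathbf\Omega_i$ by appending the real line with Lebesgue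 measure (any other extension to a $\sigma$-finite space of infinite measure gives the same value), and $\nu$ ranges over the couplings of the two extended measures. For arbitrary graphexes $\mathbb W_1,\mathbb W_2$, $\delta_\diamond(\mathbb W_1,\mathbb W_2)$ is the infimum of all $c\ge0$ for which there are measures $\widetilde\mu_i$ on $\Omega_i$ ($i=1,2$) with $\mu_i(B)-c^2\le\widetilde\mu_i(B)\le\mu_i(B)$ for all measurable $B$, such that the $\widetilde{\mathbb W}_i$ obtained from $\mathbb W_i$ by replacing $\mu_i$ with $\widetilde\mu_i$ are in $L^1\cap L^2$ and $\delta_{2\to2}(\widetilde{\mathbb W}_1,\widetilde{\mathbb W}_2)\le c$. **Theorem.** Let $\mathbb W_i=(W_i,S_i,I_i,\mathbf\Omega_i)$, $i=1,2$, be graphexes over $\sigma$-finite Borel spaces $\mathbf\Omega_i=(\Omega_i,\mathcal F_i,\mu_i)$, that is, $(\Omega_i,\mathcal F_i)$ is isomorphic to a Borel subset of a complete separable metric space. Suppose that $D_{\mathbb W_i}>0$ everywhere on $\Omega_i$ for $i=1,2$ and that $\delta_\diamond(\mathbb W_1,\mathbb W_2)=0$. Then $\mu_1(\Omega_1)=\mu_2(\Omega_2)$,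 $I_1=I_2$, and there exists a coupling $\nu$ of $\mu_1$ and $\mu_2$ such that $W_1^{\pi_1}=W_2^{\pi_2}$ $(\nu\times\nu)$-almost everywhere and $S_1^{\pi_1}=S_2^{\pi_2}$ $\nu$-almost everywhere. -/

import Mathlib

open MeasureTheory
open scoped ENNReal NNReal

noncomputable section

namespace Graphex

/-- A graphon part `W`, a star part `S` and a dust part `I` on a set `Ω`. The measure on `Ω` is kept
separate, because it is varied in the definition of the distances. -/
structure Triple (Ω : Type*) where
  W : Ω → Ω → ℝ
  S : Ω → ℝ
  I : ℝ

namespace Triple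

variable {Ω : Type*} {Ω' : Type*}

/-- The pullback along a map `φ`. -/
def pullback (𝕎 : Triple Ω) (φ : Ω' → Ω) : Triple Ω' where
  W x y := 𝕎.W (φ x) (φ y)
  S x := 𝕎.S (φ x)
  I := 𝕎.I

/-- The extension by zero to `Ω ⊕ ℝ`. -/
def extend (𝕎 : Triple Ω) : Triple (Ω ⊕ ℝ) where
  W := Sum.elim (fun x => Sum.elim (fun y => 𝕎.W x y) (fun _ => 0)) (fun _ _ => 0)
  S := Sum.elim 𝕎.S (fun _ => 0)
  I := 𝕎.I

variable [MeasurableSpace Ω]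

/-- `‖𝕎‖₁ = ∫ |W| + 2 ∫ |S| + 2 |I|`, as an extended nonnegative number. -/
def norm1 (𝕎 : Triple Ω) (μ : Measure Ω) : ℝ≥0∞ :=
  (∫⁻ p, ‖𝕎.W p.1 p.2‖ₑ ∂(μ.prod μ)) + 2 * (∫⁻ x, ‖𝕎.S x‖ₑ ∂μ) + 2 * ‖𝕎.I‖ₑ

/-- The marginal `D_{|𝕎|}(x) = ∫ |W(x,y)| dμ(y) + |S(x)|`, with values in `[0,∞]`.
If `W` and `S` are nonnegative this is the marginal `D_𝕎` of `𝕎`. -/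
def absMarginal (𝕎 : Triple Ω) (μ : Measure Ω) (x : Ω) : ℝ≥0∞ :=
  (∫⁻ y, ‖𝕎.W x y‖ₑ ∂μ) + ‖𝕎.S x‖ₑ

/-- The real-valued (signed) marginal `D_𝕎(x) = ∫ W(x,y) dμ(y) + S(x)`. It is only used for `𝕎` in
`L¹ ∩ L²`, where the integral converges for almost every `x`. -/
def marginal (𝕎 : Triple Ω) (μ : Measure Ω) (x : Ω) : ℝ :=
  (∫ y, 𝕎.W x y ∂μ) + 𝕎.S x

/-- The edge density `ρ(𝕎) = ∫ W + 2 ∫ S + 2 I`, used for `𝕎` in `L¹ ∩ L²`. -/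
def edgeDensity (𝕎 : Triple Ω) (μ : Measure Ω) : ℝ :=
  (∫ p, 𝕎.W p.1 p.2 ∂(μ.prod μ)) + 2 * (∫ x, 𝕎.S x ∂μ) + 2 * 𝕎.I

/-- `𝕎` is in `L¹ ∩ L²`: both `W` and `D_{|𝕎|}` are. -/
structure MemL1L2 (𝕎 : Triple Ω) (μ : Measure Ω) : Prop where
  memLp_W_one : MemLp (fun p : Ω × Ω => 𝕎.W p.1 p.2) 1 (μ.prod μ)
  memLp_W_two : MemLp (fun p : Ω × Ω => 𝕎.W p.1 p.2) 2 (μ.prod μ)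
  memLp_D_one : MemLp (𝕎.absMarginal μ) 1 μ
  memLp_D_two : MemLp (𝕎.absMarginal μ) 2 μ

end Triple

/-- `(W, S, I, (Ω, μ))` is a graphex. The integrability of the restriction of `𝕎` to `A` is
expressed with the restricted measure. -/
structure IsGraphex {Ω : Type*} [MeasurableSpace Ω] (𝕎 : Triple Ω) (μ : Measure Ω) : Prop where
  sigmaFinite : SigmaFinite μ
  measurable_W : Measurable (fun p : Ω × Ω => 𝕎.W p.1 p.2)
  symm_W : ∀ x y, 𝕎.W x y = 𝕎.W y x
  W_mem : ∀ x y, 𝕎.W x y ∈ Set.Icc (0 : ℝ) 1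
  measurable_S : Measurable 𝕎.S
  S_nonneg : ∀ x, 0 ≤ 𝕎.S x
  I_nonneg : 0 ≤ 𝕎.I
  ae_integrable : ∀ᵐ x ∂μ, Integrable (fun y => 𝕎.W y x) μ
  exists_integrable_restrict :
    ∃ A : Set Ω, MeasurableSet A ∧ μ Aᶜ < ∞ ∧ 𝕎.norm1 (μ.restrict A) < ∞

/-- The kernel norm `‖U‖_{2→2} = sup {f ∘ U ∘ g : ‖f‖₂ = ‖g‖₂ = 1}`. The supremum may be taken in
`[0,∞]`, since replacing `f` by `-f` changes the sign of `f ∘ U ∘ g`. -/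
def kernelNorm {Ω : Type*} [MeasurableSpace Ω] (U : Ω → Ω → ℝ) (μ : Measure Ω) : ℝ≥0∞ :=
  ⨆ (f : Ω → ℝ) (g : Ω → ℝ) (_ : Measurable f) (_ : Measurable g)
    (_ : eLpNorm f 2 μ = 1) (_ : eLpNorm g 2 μ = 1),
    ENNReal.ofReal (∫ p, f p.1 * U p.1 p.2 * g p.2 ∂(μ.prod μ))

/-- The distance `d_{2→2}` of two triples over the same measure space. -/
def d22 {Ω : Type*} [MeasurableSpace Ω] (𝕎₁ 𝕎₂ : Triple Ω) (μ : Measure Ω) : ℝ≥0∞ :=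
  max (kernelNorm (fun x y => 𝕎₁.W x y - 𝕎₂.W x y) μ)
    (max ((eLpNorm (fun x => 𝕎₁.marginal μ x - 𝕎₂.marginal μ x) 2 μ) ^ (1 / 2 : ℝ))
      (ENNReal.ofReal |𝕎₁.edgeDensity μ - 𝕎₂.edgeDensity μ| ^ (1 / 3 : ℝ)))

/-- `ν` is a coupling of `μ₁` and `μ₂`. -/
def IsCoupling {Ω₁ Ω₂ : Type*} [MeasurableSpace Ω₁] [MeasurableSpace Ω₂]
    (ν : Measure (Ω₁ × Ω₂)) (μ₁ : Measure Ω₁) (μ₂ : Measure Ω₂) : Prop :=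
  ν.map Prod.fst = μ₁ ∧ ν.map Prod.snd = μ₂

/-- The infimum of `d_{2→2}(𝕎₁^{π₁,ν}, 𝕎₂^{π₂,ν})` over all couplings `ν` of `μ₁` and `μ₂`. -/
def couplingDist {Ω₁ Ω₂ : Type*} [MeasurableSpace Ω₁] [MeasurableSpace Ω₂]
    (𝕎₁ : Triple Ω₁) (μ₁ : Measure Ω₁) (𝕎₂ : Triple Ω₂) (μ₂ : Measure Ω₂) : ℝ≥0∞ :=
  ⨅ (ν : Measure (Ω₁ × Ω₂)) (_ : IsCoupling ν μ₁ μ₂),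
    d22 (𝕎₁.pullback Prod.fst) (𝕎₂.pullback Prod.snd) ν

/-- The measure on `Ω ⊕ ℝ` that is `μ` on `Ω` and Lebesgue measure on `ℝ`. -/
def extendMeasure {Ω : Type*} [MeasurableSpace Ω] (μ : Measure Ω) : Measure (Ω ⊕ ℝ) :=
  μ.map Sum.inl + (volume : Measure ℝ).map Sum.inr

/-- The kernel distance `δ_{2→2}`: the coupling distance of trivial extensions to spaces of infinite
total measure. The extension used is the one that appends the real line with Lebesgue measure; the
value for triples in `L¹ ∩ L²` is the same for every choice. -/
def kernelDist {Ω₁ Ω₂ : Type*} [MeasurableSpace Ω₁] [MeasurableSpace Ω₂]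
    (𝕎₁ : Triple Ω₁) (μ₁ : Measure Ω₁) (𝕎₂ : Triple Ω₂) (μ₂ : Measure Ω₂) : ℝ≥0∞ :=
  couplingDist 𝕎₁.extend (extendMeasure μ₁) 𝕎₂.extend (extendMeasure μ₂)

/-- `μ - r ≤ μ' ≤ μ`. -/
def IsNearSubmeasure {Ω : Type*} [MeasurableSpace Ω] (μ' μ : Measure Ω) (r : ℝ≥0∞) : Prop :=
  ∀ B : Set Ω, MeasurableSet B → μ B ≤ μ' B + r ∧ μ' B ≤ μ B

/-- The weak kernel distance `δ_⋄`. -/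
def weakKernelDist {Ω₁ Ω₂ : Type*} [MeasurableSpace Ω₁] [MeasurableSpace Ω₂]
    (𝕎₁ : Triple Ω₁) (μ₁ : Measure Ω₁) (𝕎₂ : Triple Ω₂) (μ₂ : Measure Ω₂) : ℝ≥0∞ :=
  ⨅ (c : ℝ≥0) (_ : ∃ (μ₁' : Measure Ω₁) (μ₂' : Measure Ω₂),
      𝕎₁.MemL1L2 μ₁' ∧ 𝕎₂.MemL1L2 μ₂' ∧
      IsNearSubmeasure μ₁' μ₁ ((c : ℝ≥0∞) ^ 2) ∧ IsNearSubmeasure μ₂' μ₂ ((c : ℝ≥0∞) ^ 2) ∧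
      kernelDist 𝕎₁ μ₁' 𝕎₂ μ₂' ≤ c), (c : ℝ≥0∞)

end Graphex

end

/-!
The proof takes a limit of near-optimal couplings. Since `δ_⋄ = 0`, there are submeasures of `μ₁` and
`μ₂` with defect at most `ε²`, and couplings `ν` of their trivial extensions, under which the kernels,
the marginals and the edge densities of the two triples are `ε`-close, for every `ε > 0`
(`exists_isLift_isClose`). As `W ≤ 1`, passing to the submeasures changes the marginals by at most
`ε²`; as the triples are integrable for the submeasures, a marginal greater than `b > 0` occurs on a
set of finite measure only.

The parts of the `ν` over `Ω₁ × Ω₂` have marginals dominated by `μ₁` and `μ₂`, so along an ultrafilter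
they converge on rectangles of points with marginals bounded away from zero, by Prokhorov's theorem
(`exists_tendsto_measure_prod`). By Chebyshev's inequality, points with marginal greater than `b` are
asymptotically never coupled to points with marginal at most `a < b`
(`IsCouplingLimit.tendsto_measure_gap`). So no mass is lost to the real line or at infinity, and as
the marginals are positive everywhere, the limit `κ` is a coupling of `μ₁` and `μ₂`
(`IsCouplingLimit.map_fst`) under which the marginals agree.

Closeness in the kernel norm, tested on indicators of rectangles, passes to the limit, because the
relevant measures are dominated by a fixed finite measure and converge setwise. Hence the kernels
agree `κ × κ`-almost everywhere (`IsCouplingLimit.ae_W_eq`), and subtracting the `W`-parts from the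
marginals shows that the star parts agree as well.

The dust parts are compared through the edge densities, which may be infinite in the limit. Removing
the set `E` of pairs of points that both have marginal greater than `1` changes an edge density by
`∫_{E × E} W - 2 ∫_E D` (`Triple.IsNonneg.norm1_add_lintegral_prod`), and this is nearly the same for
both triples, as it involves the kernels and the marginals tested on a set of bounded measure only.
What remains are the total masses on the sets of marginal at most `1`; these are finite and stable
under passing to submeasures of small defect, so they agree in the limit
(`IsCouplingLimit.norm1_restrict_le`), and so do `I₁` and `I₂`.
-/

noncomputable section

namespace Graphex

open Filter Topology Set
open scoped BoundedContinuousFunction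

/-! ### Limits of measures on products with dominated marginals -/

theorem measure_le_of_forall_lintegral_le {X : Type*} [MeasurableSpace X] [TopologicalSpace X]
    [HasOuterApproxClosed X] [BorelSpace X] {α M : Measure X} [α.WeaklyRegular]
    [IsFiniteMeasure M] (h : ∀ f : X →ᵇ ℝ≥0, ∫⁻ x, f x ∂α ≤ ∫⁻ x, f x ∂M) (hα : α univ ≠ ∞) :
    α ≤ M := by
  have hclosed : ∀ F : Set X, IsClosed F → α F ≤ M F := fun F hF =>
    ge_of_tendsto' (HasOuterApproxClosed.tendsto_lintegral_apprSeq hF M) fun n =>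
      (HasOuterApproxClosed.measure_le_lintegral hF α n).trans (h _)
  refine Measure.le_iff.2 fun A hA => ?_
  rw [hA.measure_eq_iSup_isClosed_of_ne_top (measure_ne_top_of_subset (subset_univ _) hα)]
  exact iSup₂_le fun K hK => iSup_le fun hKc => (hclosed K hKc).trans (measure_mono hK)

theorem exists_boundedContinuous_approx_indicator {X : Type*} [MeasurableSpace X]
    [TopologicalSpace X] [NormalSpace X] [BorelSpace X] {M : Measure X} [M.WeaklyRegular]
    [IsFiniteMeasure M] {A : Set X} (hA : MeasurableSet A) {ε : ℝ} (hε : 0 < ε) :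
    ∃ g : X →ᵇ ℝ, (∫ x, ‖A.indicator (fun _ => (1 : ℝ)) x - g x‖ ∂M) ≤ ε ∧ Integrable g M :=
  (integrable_const (1 : ℝ)).indicator hA |>.exists_boundedContinuous_integral_sub_le hε

theorem integral_comp_le_of_map_le {Z X : Type*} [MeasurableSpace Z] [MeasurableSpace X]
    {κ : Measure Z} {M : Measure X} {π : Z → X} (hπ : Measurable π) (h : κ.map π ≤ M)
    {f : X → ℝ} (hf : Integrable f M) (h0 : ∀ x, 0 ≤ f x) :
    ∫ z, f (π z) ∂κ ≤ ∫ x, f x ∂M := by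
  rw [← integral_map hπ.aemeasurable (hf.mono_measure h).aestronglyMeasurable]
  exact integral_mono_measure h (ae_of_all _ h0) hf

theorem integrable_comp_of_map_le {Z X : Type*} [MeasurableSpace Z] [MeasurableSpace X]
    {κ : Measure Z} {M : Measure X} {π : Z → X} (hπ : Measurable π) (h : κ.map π ≤ M)
    {f : X → ℝ} (hf : Integrable f M) : Integrable (fun z => f (π z)) κ :=
  (hf.mono_measure h).comp_measurable hπ

/-- A rectangle is approximated, uniformly over all measures with marginals dominated by `M₁` and
`M₂`, by a product of functions approximating its sides in `L¹(M₁)` and `L¹(M₂)`. -/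
theorem abs_measureReal_prod_sub_integral_le {X Y : Type*} [MeasurableSpace X] [MeasurableSpace Y]
    {M₁ : Measure X} {M₂ : Measure Y} [IsFiniteMeasure M₁] [IsFiniteMeasure M₂]
    {κ : Measure (X × Y)} (h₁ : κ.map Prod.fst ≤ M₁) (h₂ : κ.map Prod.snd ≤ M₂)
    [IsFiniteMeasure κ] {A : Set X} {B : Set Y} (hA : MeasurableSet A) (hB : MeasurableSet B)
    {u : X → ℝ} {v : Y → ℝ} (hu : Integrable u M₁) (hv : Integrable v M₂) {c : ℝ}
    (hum : Measurable u) (hc0 : 0 ≤ c) (hc : ∀ x, ‖u x‖ ≤ c) :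
    |κ.real (A ×ˢ B) - ∫ p, u p.1 * v p.2 ∂κ| ≤
      ∫ x, ‖A.indicator (fun _ => (1 : ℝ)) x - u x‖ ∂M₁ +
        c * ∫ y, ‖B.indicator (fun _ => (1 : ℝ)) y - v y‖ ∂M₂ := by
  set a : X → ℝ := A.indicator (fun _ => (1 : ℝ))
  set b : Y → ℝ := B.indicator (fun _ => (1 : ℝ))
  have ha : Integrable a M₁ := (integrable_const (1 : ℝ)).indicator hA
  have hb : Integrable b M₂ := (integrable_const (1 : ℝ)).indicator hB
  have hab : (fun p : X × Y => a p.1 * b p.2) = (A ×ˢ B).indicator (fun _ => (1 : ℝ)) := by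
    ext p
    by_cases h1 : p.1 ∈ A <;> by_cases h2 : p.2 ∈ B <;> simp [a, b, h1, h2, indicator]
  have hI : κ.real (A ×ˢ B) = ∫ p, a p.1 * b p.2 ∂κ := by
    rw [hab, integral_indicator (hA.prod hB)]; simp
  have i1 : Integrable (fun p : X × Y => a p.1 * b p.2) κ := by
    rw [hab]; exact (integrable_const (1 : ℝ)).indicator (hA.prod hB)
  have hv' : Integrable (fun p : X × Y => v p.2) κ :=
    integrable_comp_of_map_le measurable_snd h₂ hv
  have i2 : Integrable (fun p : X × Y => u p.1 * v p.2) κ :=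
    hv'.bdd_mul (hum.comp measurable_fst).aestronglyMeasurable (ae_of_all _ fun p => hc p.1)
  have i3 : Integrable (fun p : X × Y => ‖a p.1 - u p.1‖) κ :=
    integrable_comp_of_map_le (f := fun x => ‖a x - u x‖) measurable_fst h₁ (ha.sub hu).norm
  have i4 : Integrable (fun p : X × Y => ‖b p.2 - v p.2‖) κ :=
    integrable_comp_of_map_le (f := fun x => ‖b x - v x‖) measurable_snd h₂ (hb.sub hv).norm
  have hpt : ∀ p : X × Y, ‖a p.1 * b p.2 - u p.1 * v p.2‖ ≤
      ‖a p.1 - u p.1‖ + c * ‖b p.2 - v p.2‖ := by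
    intro p
    have hb1 : ‖b p.2‖ ≤ 1 := by
      by_cases h2 : p.2 ∈ B <;> simp [b, h2]
    calc ‖a p.1 * b p.2 - u p.1 * v p.2‖
        = ‖(a p.1 - u p.1) * b p.2 + u p.1 * (b p.2 - v p.2)‖ := by congr 1; ring
      _ ≤ ‖a p.1 - u p.1‖ * ‖b p.2‖ + ‖u p.1‖ * ‖b p.2 - v p.2‖ := by
          rw [← norm_mul, ← norm_mul]; exact norm_add_le _ _
      _ ≤ ‖a p.1 - u p.1‖ * 1 + c * ‖b p.2 - v p.2‖ := by
          gcongr; exact hc _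
      _ = _ := by rw [mul_one]
  rw [hI, ← integral_sub i1 i2, ← Real.norm_eq_abs]
  refine (norm_integral_le_integral_norm _).trans ?_
  refine (integral_mono (i1.sub i2).norm (i3.add (i4.const_mul c)) hpt).trans ?_
  simp only [Pi.add_apply]
  rw [integral_add i3 (i4.const_mul c), integral_const_mul]
  have e1 := integral_comp_le_of_map_le (f := fun x => ‖a x - u x‖) measurable_fst h₁
    (ha.sub hu).norm fun _ => norm_nonneg _
  have e2 := integral_comp_le_of_map_le (f := fun x => ‖b x - v x‖) measurable_snd h₂
    (hb.sub hv).norm fun _ => norm_nonneg _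
  exact add_le_add e1 (mul_le_mul_of_nonneg_left e2 hc0)

/-- Measures on a product whose marginals are dominated by fixed finite measures converge on all
rectangles along an ultrafilter. They are tight, so Prokhorov's theorem gives a weak limit; the
domination of the marginals lets continuous functions approximate the sides of a rectangle in `L¹`. -/
theorem exists_tendsto_measure_prod_of_finite {ι X Y : Type*} [MeasurableSpace X]
    [StandardBorelSpace X] [MeasurableSpace Y] [StandardBorelSpace Y] (𝒰 : Ultrafilter ι)
    (M₁ : Measure X) (M₂ : Measure Y) [IsFiniteMeasure M₁] [IsFiniteMeasure M₂]
    (κ : ι → Measure (X × Y)) (h₁ : ∀ i, (κ i).map Prod.fst ≤ M₁)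
    (h₂ : ∀ i, (κ i).map Prod.snd ≤ M₂) :
    ∃ κ' : Measure (X × Y), IsFiniteMeasure κ' ∧ ∀ A B, MeasurableSet A → MeasurableSet B →
      Tendsto (fun i => κ i (A ×ˢ B)) 𝒰 (𝓝 (κ' (A ×ˢ B))) := by
  let := upgradeStandardBorel X
  let := upgradeStandardBorel Y
  have hfst : ∀ i (A : Set X), MeasurableSet A → κ i (Prod.fst ⁻¹' A) ≤ M₁ A := fun i A hA => by
    rw [← Measure.map_apply measurable_fst hA]; exact h₁ i A
  have hsnd : ∀ i (A : Set Y), MeasurableSet A → κ i (Prod.snd ⁻¹' A) ≤ M₂ A := fun i A hA => by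
    rw [← Measure.map_apply measurable_snd hA]; exact h₂ i A
  have hfin : ∀ i, IsFiniteMeasure (κ i) := fun i =>
    ⟨(hfst i univ .univ).trans_lt (measure_lt_top M₁ univ)⟩
  have ht₁ := isTightMeasureSet_iff_exists_isCompact_measure_compl_le.1
    (isTightMeasureSet_singleton (μ := M₁))
  have ht₂ := isTightMeasureSet_iff_exists_isCompact_measure_compl_le.1
    (isTightMeasureSet_singleton (μ := M₂))
  -- the compact sets `K₁ n ×ˢ K₂ n` carry all but `(1 / 2) ^ n` of the mass of each `κ i`
  let u : ℕ → ℝ≥0 := fun n => (1 / 2) ^ n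
  have hu : ∀ n, 0 < u n := fun n => by positivity
  have hu' : Tendsto u atTop (𝓝 0) := tendsto_pow_atTop_nhds_zero_of_lt_one (by positivity)
    (by rw [div_lt_one] <;> norm_num)
  choose K₁ hK₁ hM₁ using fun n => ht₁ (u n / 2 : ℝ≥0) (by exact_mod_cast half_pos (hu n))
  choose K₂ hK₂ hM₂ using fun n => ht₂ (u n / 2 : ℝ≥0) (by exact_mod_cast half_pos (hu n))
  have hcomp := isCompact_setOfPred_finiteMeasure_mass_le_compl_isCompact_le
    (E := X × Y) (u := u) (K := fun n => K₁ n ×ˢ K₂ n) (M₁ univ).toNNReal hu'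
    (fun n => (hK₁ n).prod (hK₂ n)) (Or.inl inferInstance)
  let κf : ι → FiniteMeasure (X × Y) := fun i => ⟨κ i, hfin i⟩
  obtain ⟨κ', -, hκ'⟩ := hcomp.ultrafilter_le_nhds' (𝒰.map κf) (by
    refine Ultrafilter.mem_map.2 (Filter.univ_mem' fun i => ⟨?_, fun n => ?_⟩)
    · refine ENNReal.toNNReal_mono (measure_ne_top _ _) ?_
      exact hfst i univ .univ
    · rw [← ENNReal.coe_le_coe, FiniteMeasure.ennreal_coeFn_eq_coeFn_toMeasure]
      have : (K₁ n ×ˢ K₂ n)ᶜ ⊆ Prod.fst ⁻¹' (K₁ n)ᶜ ∪ Prod.snd ⁻¹' (K₂ n)ᶜ := by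
        intro p hp
        by_contra h
        simp only [mem_union, mem_preimage, mem_compl_iff, not_or, not_not] at h
        exact hp ⟨h.1, h.2⟩
      refine (measure_mono this).trans ((measure_union_le _ _).trans ?_)
      calc _ ≤ ((u n / 2 : ℝ≥0) : ℝ≥0∞) + ((u n / 2 : ℝ≥0) : ℝ≥0∞) :=
            add_le_add ((hfst i _ (hK₁ n).measurableSet.compl).trans (hM₁ n _ rfl))
              ((hsnd i _ (hK₂ n).measurableSet.compl).trans (hM₂ n _ rfl))
        _ = _ := by rw [← ENNReal.coe_add, add_halves])
  have hlim : Tendsto κf 𝒰 (𝓝 κ') := hκ'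
  have hlim1 := FiniteMeasure.tendsto_iff_forall_lintegral_tendsto.1 hlim
  have hlim2 := FiniteMeasure.tendsto_iff_forall_integral_tendsto.1 hlim
  have h₁' : (κ' : Measure (X × Y)).map Prod.fst ≤ M₁ := by
    refine measure_le_of_forall_lintegral_le (fun f => ?_) (measure_ne_top _ _)
    rw [lintegral_map (by fun_prop) measurable_fst]
    refine le_of_tendsto (hlim1 (f.compContinuous ⟨Prod.fst, continuous_fst⟩)) ?_
    refine Eventually.of_forall fun i => ?_
    refine le_trans (le_of_eq ?_) (lintegral_mono' (h₁ i) le_rfl)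
    rw [lintegral_map (by fun_prop) measurable_fst]
    rfl
  have h₂' : (κ' : Measure (X × Y)).map Prod.snd ≤ M₂ := by
    refine measure_le_of_forall_lintegral_le (fun f => ?_) (measure_ne_top _ _)
    rw [lintegral_map (by fun_prop) measurable_snd]
    refine le_of_tendsto (hlim1 (f.compContinuous ⟨Prod.snd, continuous_snd⟩)) ?_
    refine Eventually.of_forall fun i => ?_
    refine le_trans (le_of_eq ?_) (lintegral_mono' (h₂ i) le_rfl)
    rw [lintegral_map (by fun_prop) measurable_snd]
    rfl
  refine ⟨κ', inferInstance, fun A B hA hB => ?_⟩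
  suffices h : Tendsto (fun i => (κ i).real (A ×ˢ B)) 𝒰
      (𝓝 ((κ' : Measure (X × Y)).real (A ×ˢ B))) by
    have := (ENNReal.continuous_ofReal.tendsto _).comp h
    simpa [Function.comp_def, Measure.real, ENNReal.ofReal_toReal, measure_ne_top] using this
  refine Metric.tendsto_nhds.2 fun ε hε => ?_
  obtain ⟨u, hu, hui⟩ := exists_boundedContinuous_approx_indicator (M := M₁) hA
    (ε := ε / 8) (by positivity)
  obtain ⟨v, hv, hvi⟩ := exists_boundedContinuous_approx_indicator (M := M₂) hB
    (ε := ε / 8 / (‖u‖ + 1)) (by positivity)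
  have hbound : ∀ (η : Measure (X × Y)) [IsFiniteMeasure η], η.map Prod.fst ≤ M₁ →
      η.map Prod.snd ≤ M₂ → |η.real (A ×ˢ B) - ∫ p, u p.1 * v p.2 ∂η| ≤ ε / 4 := by
    intro η _ e1 e2
    refine (abs_measureReal_prod_sub_integral_le e1 e2 hA hB hui hvi u.continuous.measurable
      (c := ‖u‖) (norm_nonneg u) u.norm_coe_le_norm).trans ?_
    have : ‖u‖ * (ε / 8 / (‖u‖ + 1)) ≤ ε / 8 := by
      rw [mul_div_assoc', div_le_iff₀ (by positivity)]
      nlinarith [norm_nonneg u]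
    have := mul_le_mul_of_nonneg_left hv (norm_nonneg u)
    linarith
  have hw := hlim2 (u.compContinuous ⟨Prod.fst, continuous_fst⟩ *
    v.compContinuous ⟨Prod.snd, continuous_snd⟩)
  filter_upwards [Metric.tendsto_nhds.1 hw (ε / 4) (by positivity)] with i hi
  have a1 := hbound (κ i) (h₁ i) (h₂ i)
  have a2 := hbound κ' h₁' h₂'
  have a3 : |(∫ p, u p.1 * v p.2 ∂(κ i)) - ∫ p, u p.1 * v p.2 ∂(κ' : Measure (X × Y))| < ε / 4 := by
    rw [← Real.dist_eq]; exact hi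
  rw [Real.dist_eq]
  rw [abs_le] at a1 a2
  rw [abs_lt] at a3 ⊢
  constructor <;> linarith [a1.1, a1.2, a2.1, a2.2, a3.1, a3.2]

theorem exists_le_mem_disjointed {Z : Type*} {U : ℕ → Set Z} {n : ℕ} {x : Z} (hx : x ∈ U n) :
    ∃ k ≤ n, x ∈ disjointed U k := by
  have h := biUnion_Iic_disjointed U n
  simp only [mem_iUnion, exists_prop, Set.ext_iff, Finset.mem_Iic] at h
  exact (h x).2 (le_partialSups U n hx)

theorem le_of_mem_disjointed {Z : Type*} {U : ℕ → Set Z} {n k : ℕ} {x : Z} (hx : x ∈ U n)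
    (hk : x ∈ disjointed U k) : k ≤ n := by
  by_contra! h
  rw [disjointed_eq_inter_compl] at hk
  exact (mem_iInter₂.1 hk.2 n h) hx

/-- Measures on a product with dominated marginals converge along an ultrafilter on the rectangles with
sides in sets `S n` and `T n` of finite measure. The limit is assembled from the limits on the
products of the differences of consecutive `S n` and consecutive `T n`. -/
theorem exists_tendsto_measure_prod {ι X Y : Type*} [MeasurableSpace X]
    [StandardBorelSpace X] [MeasurableSpace Y] [StandardBorelSpace Y] (𝒰 : Ultrafilter ι)
    (m₁ : Measure X) (m₂ : Measure Y) {S : ℕ → Set X} {T : ℕ → Set Y}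
    (hS : ∀ n, MeasurableSet (S n)) (hT : ∀ n, MeasurableSet (T n))
    (hSf : ∀ n, m₁ (S n) < ∞) (hTf : ∀ n, m₂ (T n) < ∞)
    (κ : ι → Measure (X × Y)) (h₁ : ∀ i, (κ i).map Prod.fst ≤ m₁)
    (h₂ : ∀ i, (κ i).map Prod.snd ≤ m₂) :
    ∃ κ' : Measure (X × Y), ∀ n A B, MeasurableSet A → MeasurableSet B → A ⊆ S n → B ⊆ T n →
      Tendsto (fun i => κ i (A ×ˢ B)) 𝒰 (𝓝 (κ' (A ×ˢ B))) := by
  let P : ℕ × ℕ → Set (X × Y) := fun j => disjointed S j.1 ×ˢ disjointed T j.2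
  have hdS := MeasurableSet.disjointed hS
  have hdT := MeasurableSet.disjointed hT
  have hP : ∀ j, MeasurableSet (P j) := fun j => (hdS _).prod (hdT _)
  have key : ∀ j : ℕ × ℕ, ∃ κ' : Measure (X × Y), IsFiniteMeasure κ' ∧
      ∀ A B, MeasurableSet A → MeasurableSet B →
        Tendsto (fun i => (κ i).restrict (P j) (A ×ˢ B)) 𝒰 (𝓝 (κ' (A ×ˢ B))) := by
    intro j
    have f1 : IsFiniteMeasure (m₁.restrict (disjointed S j.1)) :=
      ⟨by simpa using (measure_mono (disjointed_subset S j.1)).trans_lt (hSf _)⟩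
    have f2 : IsFiniteMeasure (m₂.restrict (disjointed T j.2)) :=
      ⟨by simpa using (measure_mono (disjointed_subset T j.2)).trans_lt (hTf _)⟩
    refine exists_tendsto_measure_prod_of_finite 𝒰 (m₁.restrict (disjointed S j.1))
      (m₂.restrict (disjointed T j.2)) _ (fun i => ?_) (fun i => ?_)
    · refine Measure.le_iff.2 fun A hA => ?_
      rw [Measure.map_apply measurable_fst hA, Measure.restrict_apply (measurable_fst hA),
        Measure.restrict_apply hA]
      refine le_trans ?_ (h₁ i _)
      rw [Measure.map_apply measurable_fst (hA.inter (hdS _))]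
      exact measure_mono fun p hp => ⟨hp.1, hp.2.1⟩
    · refine Measure.le_iff.2 fun A hA => ?_
      rw [Measure.map_apply measurable_snd hA, Measure.restrict_apply (measurable_snd hA),
        Measure.restrict_apply hA]
      refine le_trans ?_ (h₂ i _)
      rw [Measure.map_apply measurable_snd (hA.inter (hdT _))]
      exact measure_mono fun p hp => ⟨hp.1, hp.2.2⟩
  choose κ' hκ'f hκ' using key
  refine ⟨Measure.sum κ', fun n A B hA hB hAS hBT => ?_⟩
  have hAB := hA.prod hB
  let F : Finset (ℕ × ℕ) := Finset.range (n + 1) ×ˢ Finset.range (n + 1)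
  have hdisj : Pairwise (Function.onFun Disjoint P) := by
    intro j k hjk
    rcases ne_or_eq j.1 k.1 with h | h
    · exact Set.Disjoint.set_prod_left (disjoint_disjointed S h) _ _
    · have : j.2 ≠ k.2 := fun h' => hjk (Prod.ext h h')
      exact Set.Disjoint.set_prod_right (disjoint_disjointed T this) _ _
  have hsum : ∀ i, κ i (A ×ˢ B) = ∑ j ∈ F, (κ i).restrict (P j) (A ×ˢ B) := by
    intro i
    simp_rw [Measure.restrict_apply hAB]
    rw [← measure_biUnion_finset]
    · congr 1
      ext p
      simp only [mem_iUnion, mem_inter_iff, exists_prop]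
      refine ⟨fun hp => ?_, fun ⟨j, _, hp⟩ => hp.1⟩
      obtain ⟨k, hk, hk'⟩ := exists_le_mem_disjointed (hAS hp.1)
      obtain ⟨l, hl, hl'⟩ := exists_le_mem_disjointed (hBT hp.2)
      exact ⟨(k, l), by simp only [F, Finset.mem_product, Finset.mem_range]; omega, hp, hk', hl'⟩
    · exact fun j _ k _ hjk => (hdisj hjk).mono inter_subset_right inter_subset_right
    · exact fun j _ => hAB.inter (hP j)
  have hzero : ∀ j ∉ F, κ' j (A ×ˢ B) = 0 := by
    intro j hj
    refine tendsto_nhds_unique (hκ' j A B hA hB) (tendsto_const_nhds.congr fun i => ?_)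
    rw [Measure.restrict_apply hAB, eq_comm]
    convert measure_empty (μ := κ i)
    refine eq_empty_of_forall_notMem fun p hp => hj ?_
    have e1 := le_of_mem_disjointed (hAS hp.1.1) hp.2.1
    have e2 := le_of_mem_disjointed (hBT hp.1.2) hp.2.2
    simp only [F, Finset.mem_product, Finset.mem_range]
    omega
  rw [Measure.sum_apply _ hAB, tsum_eq_sum hzero]
  simp_rw [hsum]
  exact tendsto_finsetSum _ fun j _ => hκ' j A B hA hB

/-! ### Setwise convergence -/

/-- Dominated convergence for series, valid along filters that are not countably generated. This is
what replaces dominated convergence of integrals along ultrafilters. -/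
theorem tendsto_tsum_ennreal {ι β : Type*} {l : Filter ι} [l.NeBot] {f : ι → β → ℝ≥0∞}
    {g b : β → ℝ≥0∞} (hb : ∑' k, b k ≠ ∞) (hfb : ∀ i k, f i k ≤ b k)
    (h : ∀ k, Tendsto (fun i => f i k) l (𝓝 (g k))) :
    Tendsto (fun i => ∑' k, f i k) l (𝓝 (∑' k, g k)) := by
  have hgb : ∀ k, g k ≤ b k := fun k => le_of_tendsto' (h k) fun i => hfb i k
  have hbk : ∀ k, b k ≠ ∞ := fun k => ENNReal.ne_top_of_tsum_ne_top hb k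
  have hfi : ∀ i, ∑' k, f i k ≠ ∞ := fun i => ne_top_of_le_ne_top hb (ENNReal.tsum_le_tsum (hfb i))
  have hgi : ∑' k, g k ≠ ∞ := ne_top_of_le_ne_top hb (ENNReal.tsum_le_tsum hgb)
  rw [← ENNReal.tendsto_toReal_iff hfi hgi]
  simp_rw [ENNReal.tsum_toReal_eq (fun k => ne_top_of_le_ne_top (hbk k) (hgb k))]
  simp_rw [fun i => ENNReal.tsum_toReal_eq (fun k => ne_top_of_le_ne_top (hbk k) (hfb i k))]
  refine tendsto_tsum_of_dominated_convergence (bound := fun k => (b k).toReal)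
    (ENNReal.summable_toReal hb) (fun k => ?_) (Eventually.of_forall fun i k => ?_)
  · exact (ENNReal.tendsto_toReal_iff (fun i => ne_top_of_le_ne_top (hbk k) (hfb i k))
      (ne_top_of_le_ne_top (hbk k) (hgb k))).2 (h k)
  · rw [Real.norm_of_nonneg ENNReal.toReal_nonneg]
    exact ENNReal.toReal_mono (hbk k) (hfb i k)

/-- Setwise convergence of dominated measures implies convergence of integrals. The integrand is a
series of simple functions, so that no countability of the filter is needed. -/
theorem tendsto_lintegral_of_setwise {ι Z : Type*} [MeasurableSpace Z] {l : Filter ι} [l.NeBot]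
    {γ : ι → Measure Z} {γ' M : Measure Z} (hM : ∀ i, γ i ≤ M)
    (h : ∀ C, MeasurableSet C → Tendsto (fun i => γ i C) l (𝓝 (γ' C)))
    {f : Z → ℝ≥0∞} (hf : Measurable f) (hfM : ∫⁻ z, f z ∂M ≠ ∞) :
    Tendsto (fun i => ∫⁻ z, f z ∂(γ i)) l (𝓝 (∫⁻ z, f z ∂γ')) := by
  have hsum : ∀ η : Measure Z, ∫⁻ z, f z ∂η =
      ∑' n, ∫⁻ z, (SimpleFunc.eapproxDiff f n z : ℝ≥0∞) ∂η := by
    intro η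
    rw [← lintegral_tsum fun n => (SimpleFunc.measurable _).coe_nnreal_ennreal.aemeasurable]
    simp_rw [SimpleFunc.tsum_eapproxDiff f hf]
  have hsimple : ∀ (η : Measure Z) n, ∫⁻ z, (SimpleFunc.eapproxDiff f n z : ℝ≥0∞) ∂η =
      ∑ x ∈ (SimpleFunc.eapproxDiff f n).range, (x : ℝ≥0∞) *
        η (SimpleFunc.eapproxDiff f n ⁻¹' {x}) := by
    intro η n
    have := ((SimpleFunc.eapproxDiff f n).map ((↑) : ℝ≥0 → ℝ≥0∞)).lintegral_eq_lintegral η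
    rw [SimpleFunc.map_lintegral] at this
    simpa using this
  simp_rw [hsum]
  refine tendsto_tsum_ennreal (b := fun n => ∫⁻ z, (SimpleFunc.eapproxDiff f n z : ℝ≥0∞) ∂M)
    (by rwa [← hsum]) (fun i n => lintegral_mono' (hM i) le_rfl) fun n => ?_
  simp_rw [hsimple]
  refine tendsto_finsetSum _ fun x _ => ENNReal.Tendsto.const_mul (h _ ?_)
    (Or.inr ENNReal.coe_ne_top)
  exact SimpleFunc.measurableSet_fiber _ _

theorem tendsto_prod_of_setwise {ι X Y : Type*} [MeasurableSpace X] [MeasurableSpace Y]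
    {l : Filter ι} [l.NeBot] {α : ι → Measure X} {α' M : Measure X} {β : ι → Measure Y}
    {β' N : Measure Y} [IsFiniteMeasure M] [IsFiniteMeasure N] (hM : ∀ i, α i ≤ M)
    (hN : ∀ i, β i ≤ N) (hα : ∀ C, MeasurableSet C → Tendsto (fun i => α i C) l (𝓝 (α' C)))
    (hβ : ∀ C, MeasurableSet C → Tendsto (fun i => β i C) l (𝓝 (β' C)))
    {C : Set (X × Y)} (hC : MeasurableSet C) :
    Tendsto (fun i => (α i).prod (β i) C) l (𝓝 (α'.prod β' C)) := by
  have hM' : α' ≤ M := Measure.le_iff.2 fun A hA => le_of_tendsto' (hα A hA) fun i => hM i A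
  have hN' : β' ≤ N := Measure.le_iff.2 fun A hA => le_of_tendsto' (hβ A hA) fun i => hN i A
  have : IsFiniteMeasure α' := isFiniteMeasure_of_le M hM'
  have : IsFiniteMeasure β' := isFiniteMeasure_of_le N hN'
  have : ∀ i, IsFiniteMeasure (α i) := fun i => isFiniteMeasure_of_le M (hM i)
  have : ∀ i, IsFiniteMeasure (β i) := fun i => isFiniteMeasure_of_le N (hN i)
  have hrect : ∀ A B, MeasurableSet A → MeasurableSet B →
      Tendsto (fun i => (α i).prod (β i) (A ×ˢ B)) l (𝓝 (α'.prod β' (A ×ˢ B))) := by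
    intro A B hA hB
    simp_rw [Measure.prod_prod]
    exact ENNReal.Tendsto.mul (hα A hA) (Or.inr (measure_ne_top _ _)) (hβ B hB)
      (Or.inr (measure_ne_top _ _))
  induction C, hC using MeasurableSpace.induction_on_inter generateFrom_prod.symm
    isPiSystem_prod with
  | empty => simp
  | basic C hC =>
    obtain ⟨A, hA, B, hB, rfl⟩ := hC
    exact hrect A B hA hB
  | compl C hC ih =>
    simp_rw [measure_compl hC (measure_ne_top _ _)]
    refine ENNReal.Tendsto.sub ?_ ih (Or.inl (measure_ne_top _ _))
    simpa using hrect univ univ .univ .univ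
  | iUnion C hd hC ih =>
    simp_rw [measure_iUnion hd hC]
    refine tendsto_tsum_ennreal (b := fun k => M.prod N (C k)) ?_ (fun i k => ?_) ih
    · rw [← measure_iUnion hd hC]; exact measure_ne_top _ _
    · exact Measure.prod_mono (hM i) (hN i) _

/-- Two finite measures on `(X × Y) × (X' × Y')` that agree on products of four sets are equal. -/
theorem measure_ext_prod_prod {X Y X' Y' : Type*} [MeasurableSpace X] [MeasurableSpace Y]
    [MeasurableSpace X'] [MeasurableSpace Y'] {η₁ η₂ : Measure ((X × Y) × (X' × Y'))}
    [IsFiniteMeasure η₁]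
    (h : ∀ A B A' B', MeasurableSet A → MeasurableSet B → MeasurableSet A' → MeasurableSet B' →
      η₁ ((A ×ˢ B) ×ˢ (A' ×ˢ B')) = η₂ ((A ×ˢ B) ×ˢ (A' ×ˢ B'))) : η₁ = η₂ := by
  have step : ∀ (η : Measure ((X × Y) × (X' × Y'))) (E : Set (X × Y)) (F : Set (X' × Y')),
      MeasurableSet E → MeasurableSet F → (η.restrict (univ ×ˢ F)).fst E = η (E ×ˢ F) := by
    intro η E F hE hF
    rw [Measure.fst_apply hE, Measure.restrict_apply (measurable_fst hE)]
    congr 1; ext p; simp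
  have step' : ∀ (η : Measure ((X × Y) × (X' × Y'))) (E : Set (X × Y)) (F : Set (X' × Y')),
      MeasurableSet E → MeasurableSet F → (η.restrict (E ×ˢ univ)).snd F = η (E ×ˢ F) := by
    intro η E F hE hF
    rw [Measure.snd_apply hF, Measure.restrict_apply (measurable_snd hF)]
    congr 1; ext p; simp [and_comm]
  have h1 : ∀ E A' B', MeasurableSet E → MeasurableSet A' → MeasurableSet B' →
      η₁ (E ×ˢ (A' ×ˢ B')) = η₂ (E ×ˢ (A' ×ˢ B')) := by
    intro E A' B' hE hA' hB'
    have := Measure.ext_prod (μ := (η₁.restrict (univ ×ˢ (A' ×ˢ B'))).fst)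
      (ν := (η₂.restrict (univ ×ˢ (A' ×ˢ B'))).fst) fun {A B} hA hB => by
        rw [step _ _ _ (hA.prod hB) (hA'.prod hB'), step _ _ _ (hA.prod hB) (hA'.prod hB')]
        exact h A B A' B' hA hB hA' hB'
    rw [← step _ _ _ hE (hA'.prod hB'), this, step _ _ _ hE (hA'.prod hB')]
  refine Measure.ext_prod fun {E F} hE hF => ?_
  have := Measure.ext_prod (μ := (η₁.restrict (E ×ˢ univ)).snd)
    (ν := (η₂.restrict (E ×ˢ univ)).snd) fun {A B} hA hB => by
      rw [step' _ _ _ hE (hA.prod hB), step' _ _ _ hE (hA.prod hB)]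
      exact h1 E A B hE hA hB
  rw [← step' _ _ _ hE hF, this, step' _ _ _ hE hF]

/-! ### Submeasures of small defect -/

theorem IsNearSubmeasure.le {Ω : Type*} [MeasurableSpace Ω] {μ' μ : Measure Ω} {r : ℝ≥0∞}
    (h : IsNearSubmeasure μ' μ r) : μ' ≤ μ :=
  Measure.le_iff.2 fun B hB => (h B hB).2

/-- By the layer cake formula, the defect `r` of a submeasure bounds the loss in the integral of a
function with values in `[0, 1]`. -/
theorem IsNearSubmeasure.lintegral_le {Ω : Type*} [MeasurableSpace Ω] {μ' μ : Measure Ω}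
    {r : ℝ≥0∞} (h : IsNearSubmeasure μ' μ r) {f : Ω → ℝ≥0∞} (hf : Measurable f)
    (hf1 : ∀ x, f x ≤ 1) : ∫⁻ x, f x ∂μ ≤ ∫⁻ x, f x ∂μ' + r := by
  have hlayer : ∀ η : Measure Ω, ∫⁻ x, f x ∂η =
      ∫⁻ t in Ioi (0 : ℝ), η {x | t < (f x).toReal} := by
    intro η
    rw [← lintegral_eq_lintegral_meas_lt η (ae_of_all _ fun _ => ENNReal.toReal_nonneg)
      hf.ennreal_toReal.aemeasurable]
    exact lintegral_congr fun x =>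
      (ENNReal.ofReal_toReal (ne_top_of_le_ne_top ENNReal.one_ne_top (hf1 x))).symm
  rw [hlayer, hlayer]
  calc ∫⁻ t in Ioi (0 : ℝ), μ {x | t < (f x).toReal}
      ≤ ∫⁻ t in Ioi (0 : ℝ), (μ' {x | t < (f x).toReal} +
          (Ioc (0 : ℝ) 1).indicator (fun _ => r) t) := by
        refine setLIntegral_mono' measurableSet_Ioi fun t ht => ?_
        by_cases ht1 : t ≤ 1
        · rw [indicator_of_mem (show t ∈ Ioc (0 : ℝ) 1 from ⟨ht, ht1⟩)]
          exact (h _ (measurableSet_lt measurable_const hf.ennreal_toReal)).1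
        · have : {x | t < (f x).toReal} = ∅ := by
            refine eq_empty_of_forall_notMem fun x hx => ht1 (hx.le.trans ?_)
            exact ENNReal.toReal_le_of_le_ofReal zero_le_one (by simpa using hf1 x)
          simp [this]
    _ = _ := by
        rw [lintegral_add_right _ (measurable_const.indicator measurableSet_Ioc),
          lintegral_indicator measurableSet_Ioc, Measure.restrict_restrict measurableSet_Ioc,
          inter_eq_left.2 Ioc_subset_Ioi_self]
        simp

/-! ### Nonnegative triples and their pullbacks -/

/-- A symmetric triple with nonnegative measurable components. Unlike in `IsGraphex`, no measure is
involved, so that the notion passes to extensions and pullbacks. -/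
structure Triple.IsNonneg {Ω : Type*} [MeasurableSpace Ω] (𝕎 : Triple Ω) : Prop where
  measurable_W : Measurable (fun p : Ω × Ω => 𝕎.W p.1 p.2)
  measurable_S : Measurable 𝕎.S
  symm_W : ∀ x y, 𝕎.W x y = 𝕎.W y x
  W_nonneg : ∀ x y, 0 ≤ 𝕎.W x y
  S_nonneg : ∀ x, 0 ≤ 𝕎.S x
  I_nonneg : 0 ≤ 𝕎.I

theorem IsGraphex.isNonneg {Ω : Type*} [MeasurableSpace Ω] {𝕎 : Triple Ω} {μ : Measure Ω}
    (h : IsGraphex 𝕎 μ) : 𝕎.IsNonneg :=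
  ⟨h.measurable_W, h.measurable_S, h.symm_W, fun x y => (h.W_mem x y).1, h.S_nonneg, h.I_nonneg⟩

theorem measurableEmbedding_inl {Ω Ω' : Type*} [MeasurableSpace Ω] [MeasurableSpace Ω'] :
    MeasurableEmbedding (Sum.inl : Ω → Ω ⊕ Ω') :=
  ⟨Sum.inl_injective, measurable_inl, fun _ hs => hs.inl_image⟩

theorem lintegral_sum_eq_comap_inl {Ω Ω' : Type*} [MeasurableSpace Ω] [MeasurableSpace Ω']
    (m : Measure (Ω ⊕ Ω')) (f : Ω ⊕ Ω' → ℝ≥0∞) (hf : ∀ t, f (Sum.inr t) = 0) :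
    ∫⁻ p, f p ∂m = ∫⁻ x, f (Sum.inl x) ∂(m.comap Sum.inl) := by
  rw [← measurableEmbedding_inl.lintegral_map, measurableEmbedding_inl.map_comap,
    ← lintegral_indicator measurableSet_range_inl]
  refine lintegral_congr ?_
  rintro (x | t) <;> simp [indicator, hf]

namespace Triple.IsNonneg

variable {Ω Z : Type*} [MeasurableSpace Ω] [MeasurableSpace Z] {𝕎 : Triple Ω}

theorem pullback (h : 𝕎.IsNonneg) {φ : Z → Ω} (hφ : Measurable φ) : (𝕎.pullback φ).IsNonneg where
  measurable_W := h.measurable_W.comp (f := fun p : Z × Z => (φ p.1, φ p.2)) (by fun_prop)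
  measurable_S := h.measurable_S.comp hφ
  symm_W _ _ := h.symm_W _ _
  W_nonneg _ _ := h.W_nonneg _ _
  S_nonneg _ := h.S_nonneg _
  I_nonneg := h.I_nonneg

theorem extend (h : 𝕎.IsNonneg) : 𝕎.extend.IsNonneg where
  measurable_W := by
    rw [← (MeasurableEquiv.sumProdSum Ω ℝ Ω ℝ).symm.measurable_comp_iff]
    refine measurable_fun_sum (measurable_fun_sum ?_ ?_) (measurable_fun_sum ?_ ?_)
    · exact h.measurable_W
    all_goals exact measurable_const
  measurable_S := measurable_fun_sum h.measurable_S measurable_const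
  symm_W := by rintro (x | x) (y | y) <;> simp [Triple.extend, h.symm_W]
  W_nonneg := by rintro (x | x) (y | y) <;> simp [Triple.extend, h.W_nonneg]
  S_nonneg := by rintro (x | x) <;> simp [Triple.extend, h.S_nonneg]
  I_nonneg := h.I_nonneg

theorem measurable_enorm_W (h : 𝕎.IsNonneg) : Measurable (fun p : Ω × Ω => ‖𝕎.W p.1 p.2‖ₑ) :=
  h.measurable_W.enorm

theorem measurable_lintegral_W (h : 𝕎.IsNonneg) (μ : Measure Ω) [SFinite μ] :
    Measurable (fun x => ∫⁻ y, ‖𝕎.W x y‖ₑ ∂μ) :=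
  h.measurable_enorm_W.lintegral_prod_right'

theorem measurable_absMarginal (h : 𝕎.IsNonneg) (μ : Measure Ω) [SFinite μ] :
    Measurable (𝕎.absMarginal μ) :=
  (h.measurable_lintegral_W μ).add h.measurable_S.enorm

theorem lintegral_absMarginal (h : 𝕎.IsNonneg) (μ : Measure Ω) [SFinite μ] :
    ∫⁻ x, 𝕎.absMarginal μ x ∂μ =
      ∫⁻ p, ‖𝕎.W p.1 p.2‖ₑ ∂(μ.prod μ) + ∫⁻ x, ‖𝕎.S x‖ₑ ∂μ := by
  rw [lintegral_prod _ h.measurable_enorm_W.aemeasurable,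
    ← lintegral_add_left (h.measurable_lintegral_W μ)]
  rfl

theorem lintegral_absMarginal_le_norm1 (h : 𝕎.IsNonneg) (μ : Measure Ω) [SFinite μ] :
    ∫⁻ x, 𝕎.absMarginal μ x ∂μ ≤ 𝕎.norm1 μ := by
  rw [h.lintegral_absMarginal, Triple.norm1, two_mul, add_assoc, add_assoc]
  gcongr
  exact le_self_add

/-- The total mass of the extended triple, computed with the part of the measure on `Ω`. -/
theorem norm1_extend (h : 𝕎.IsNonneg) (m : Measure (Ω ⊕ ℝ)) [SFinite m]
    [SFinite (m.comap Sum.inl)] :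
    𝕎.extend.norm1 m = 𝕎.norm1 (m.comap Sum.inl) := by
  rw [Triple.norm1, Triple.norm1, lintegral_prod _ h.extend.measurable_enorm_W.aemeasurable,
    lintegral_prod _ h.measurable_enorm_W.aemeasurable, lintegral_sum_eq_comap_inl m,
    lintegral_sum_eq_comap_inl m]
  · congr 3
    funext x
    rw [lintegral_sum_eq_comap_inl _ _ (by simp [Triple.extend])]
    simp [Triple.extend]
  · simp [Triple.extend]
  · simp [Triple.extend]

theorem _root_.Graphex.Triple.absMarginal_extend (m : Measure (Ω ⊕ ℝ)) (p : Ω ⊕ ℝ) :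
    𝕎.extend.absMarginal m p = Sum.elim (𝕎.absMarginal (m.comap Sum.inl)) (fun _ => 0) p := by
  rcases p with x | t
  · rw [Triple.absMarginal, lintegral_sum_eq_comap_inl _ _ (by simp [Triple.extend])]
    simp [Triple.extend, Triple.absMarginal]
  · simp [Triple.extend, Triple.absMarginal]

theorem norm1_pullback (h : 𝕎.IsNonneg) {φ : Z → Ω} (hφ : Measurable φ) (ν : Measure Z)
    [SFinite ν] : (𝕎.pullback φ).norm1 ν = 𝕎.norm1 (ν.map φ) := by
  rw [Triple.norm1, Triple.norm1, lintegral_map h.measurable_S.enorm hφ,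
    Measure.map_prod_map _ _ hφ hφ, lintegral_map h.measurable_enorm_W (by fun_prop)]
  rfl

theorem absMarginal_pullback (h : 𝕎.IsNonneg) {φ : Z → Ω} (hφ : Measurable φ) (ν : Measure Z)
    (z : Z) : (𝕎.pullback φ).absMarginal ν z = 𝕎.absMarginal (ν.map φ) (φ z) := by
  rw [Triple.absMarginal, Triple.absMarginal,
    lintegral_map (f := fun y => ‖𝕎.W (φ z) y‖ₑ)
      (h.measurable_W.comp (measurable_prodMk_left (x := φ z))).enorm hφ]
  rfl

end Triple.IsNonneg

theorem comap_inl_extendMeasure {Ω : Type*} [MeasurableSpace Ω] (μ : Measure Ω) :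
    (extendMeasure μ).comap Sum.inl = μ := by
  ext A hA
  rw [measurableEmbedding_inl.comap_apply, extendMeasure, Measure.add_apply,
    Measure.map_apply measurable_inl hA.inl_image, Measure.map_apply measurable_inr hA.inl_image,
    preimage_image_eq _ Sum.inl_injective]
  simp

instance {Ω : Type*} [MeasurableSpace Ω] (μ : Measure Ω) [SigmaFinite μ] :
    SigmaFinite (extendMeasure μ) := by
  have hinl : ∀ n, MeasurableSet (Sum.inl '' spanningSets μ n : Set (Ω ⊕ ℝ)) := fun n =>
    (measurableSet_spanningSets μ n).inl_image
  have hinr : ∀ n, MeasurableSet (Sum.inr '' spanningSets (volume : Measure ℝ) n : Set (Ω ⊕ ℝ)) :=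
    fun n => (measurableSet_spanningSets _ n).inr_image
  refine ⟨⟨⟨fun n => Sum.inl '' spanningSets μ n ∪ Sum.inr '' spanningSets (volume : Measure ℝ) n,
    fun _ => trivial, fun n => ?_, ?_⟩⟩⟩
  · have hm := (hinl n).union (hinr n)
    rw [extendMeasure, Measure.add_apply, Measure.map_apply measurable_inl hm,
      Measure.map_apply measurable_inr hm]
    simp only [preimage_union, preimage_image_eq _ Sum.inl_injective,
      preimage_image_eq _ Sum.inr_injective, preimage_inl_image_inr, preimage_inr_image_inl,
      union_empty, empty_union]
    exact ENNReal.add_lt_top.2 ⟨measure_spanningSets_lt_top μ n, measure_spanningSets_lt_top _ n⟩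
  · rw [iUnion_union_distrib, ← image_iUnion, ← image_iUnion, iUnion_spanningSets,
      iUnion_spanningSets, image_univ, image_univ, range_inl_union_range_inr]

/-! ### Lifts of submeasures and close triples -/

/-- `π : Z → Ω ⊕ ℝ` exhibits `ν` as a lift of the trivial extension of a submeasure `μ'` of `μ`
with defect at most `ε²`, for which `𝕎` has finite total mass. -/
structure IsLift {Ω Z : Type*} [MeasurableSpace Ω] [MeasurableSpace Z] (𝕎 : Triple Ω)
    (μ μ' : Measure Ω) (ν : Measure Z) (π : Z → Ω ⊕ ℝ) (ε : ℝ≥0∞) : Prop where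
  measurable : Measurable π
  map_eq : ν.map π = extendMeasure μ'
  near : IsNearSubmeasure μ' μ (ε ^ 2)
  norm1_lt_top : 𝕎.norm1 μ' < ∞

/-- The one-sided bounds that `d22 𝕍₁ 𝕍₂ ν ≤ ε` implies for nonnegative triples, stated with
`[0, ∞]`-valued integrals so that they can be used without integrability conditions. The bound on the
kernels is tested on indicators only, and the one on the marginals is the Cauchy-Schwarz inequality
on a set `E`. -/
structure IsClose {Z : Type*} [MeasurableSpace Z] (𝕍₁ 𝕍₂ : Triple Z) (ν : Measure Z)
    (ε : ℝ≥0∞) : Prop where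
  W_le : ∀ E F, MeasurableSet E → MeasurableSet F → ν E < ∞ → ν F < ∞ →
    ∫⁻ p, ‖𝕍₁.W p.1 p.2‖ₑ ∂((ν.restrict E).prod (ν.restrict F)) ≤
      ∫⁻ p, ‖𝕍₂.W p.1 p.2‖ₑ ∂((ν.restrict E).prod (ν.restrict F)) +
        ε * (ν E ^ (1 / 2 : ℝ) * ν F ^ (1 / 2 : ℝ))
  D_le : ∀ E, MeasurableSet E →
    ∫⁻ z in E, 𝕍₁.absMarginal ν z ∂ν ≤
      ∫⁻ z in E, 𝕍₂.absMarginal ν z ∂ν + ε ^ 2 * ν E ^ (1 / 2 : ℝ)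
  norm1_le : 𝕍₁.norm1 ν ≤ 𝕍₂.norm1 ν + ε ^ 3

/-! ### Bounds implied by the distance -/

theorem le_add_of_ofReal_sub_le {a b r : ℝ≥0∞} (hb : b ≠ ∞) (ha : a ≠ ∞)
    (h : ENNReal.ofReal (a.toReal - b.toReal) ≤ r) : a ≤ b + r := by
  rw [ENNReal.ofReal_sub _ ENNReal.toReal_nonneg, ENNReal.ofReal_toReal ha,
    ENNReal.ofReal_toReal hb] at h
  rw [add_comm]
  exact tsub_le_iff_right.1 h

/-- The kernel norm, tested on the normalized indicators of `E` and `F`. -/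
theorem ofReal_integral_rect_le_kernelNorm_mul {Z : Type*} [MeasurableSpace Z] {U : Z → Z → ℝ} {ν : Measure Z}
    [SFinite ν] {E F : Set Z} (hE : MeasurableSet E) (hF : MeasurableSet F) (hEf : ν E ≠ ∞)
    (hFf : ν F ≠ ∞) :
    ENNReal.ofReal (∫ p, U p.1 p.2 ∂((ν.restrict E).prod (ν.restrict F))) ≤
      kernelNorm U ν * (ν E ^ (1 / 2 : ℝ) * ν F ^ (1 / 2 : ℝ)) := by
  rcases eq_or_ne (ν E) 0 with h | hE0
  · simp [Measure.restrict_eq_zero.2 h]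
  rcases eq_or_ne (ν F) 0 with h | hF0
  · simp [Measure.restrict_eq_zero.2 h]
  have aux : ∀ {G : Set Z}, MeasurableSet G → ν G ≠ ∞ → ν G ≠ 0 →
      eLpNorm (G.indicator fun _ => ((ν G ^ (1 / 2 : ℝ)).toReal)⁻¹) 2 ν = 1 := by
    intro G hG hf h0
    have h1 : ν G ^ (1 / 2 : ℝ) ≠ ∞ := ENNReal.rpow_ne_top_of_nonneg (by norm_num) hf
    have h2 : ν G ^ (1 / 2 : ℝ) ≠ 0 := by simp [ENNReal.rpow_eq_zero_iff, h0]
    rw [eLpNorm_indicator_const hG (by norm_num) (by norm_num), ← ENNReal.toReal_inv,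
      Real.enorm_of_nonneg ENNReal.toReal_nonneg, ENNReal.ofReal_toReal (by simp [h0])]
    simpa using ENNReal.inv_mul_cancel h2 h1
  set cE := (ν E ^ (1 / 2 : ℝ)) with hcE
  set cF := (ν F ^ (1 / 2 : ℝ)) with hcF
  have hcEt : cE ≠ ∞ := ENNReal.rpow_ne_top_of_nonneg (by norm_num) hEf
  have hcFt : cF ≠ ∞ := ENNReal.rpow_ne_top_of_nonneg (by norm_num) hFf
  have hcE0 : cE ≠ 0 := by simp [hcE, ENNReal.rpow_eq_zero_iff, hE0]
  have hcF0 : cF ≠ 0 := by simp [hcF, ENNReal.rpow_eq_zero_iff, hF0]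
  have key : ENNReal.ofReal (∫ p, (E.indicator (fun _ => (cE.toReal)⁻¹)) p.1 * U p.1 p.2 *
      (F.indicator (fun _ => (cF.toReal)⁻¹)) p.2 ∂(ν.prod ν)) ≤ kernelNorm U ν := by
    unfold kernelNorm
    refine le_iSup_of_le (E.indicator (fun _ => (cE.toReal)⁻¹)) ?_
    refine le_iSup_of_le (F.indicator (fun _ => (cF.toReal)⁻¹)) ?_
    refine le_iSup_of_le (measurable_const.indicator hE) ?_
    refine le_iSup_of_le (measurable_const.indicator hF) ?_
    refine le_iSup_of_le (aux hE hEf hE0) ?_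
    exact le_iSup_of_le (aux hF hFf hF0) le_rfl
  have hint : ∫ p, (E.indicator (fun _ => (cE.toReal)⁻¹)) p.1 * U p.1 p.2 *
      (F.indicator (fun _ => (cF.toReal)⁻¹)) p.2 ∂(ν.prod ν) =
      (cE.toReal)⁻¹ * (cF.toReal)⁻¹ *
        ∫ p, U p.1 p.2 ∂((ν.restrict E).prod (ν.restrict F)) := by
    rw [Measure.prod_restrict, ← integral_indicator (hE.prod hF), ← integral_const_mul]
    refine integral_congr_ae (ae_of_all _ fun p => ?_)
    by_cases h1 : p.1 ∈ E <;> by_cases h2 : p.2 ∈ F <;> simp [indicator, h1, h2]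
    ring
  rw [hint, ENNReal.ofReal_mul (by positivity), ENNReal.ofReal_mul (by positivity),
    ENNReal.ofReal_inv_of_pos (ENNReal.toReal_pos hcE0 hcEt),
    ENNReal.ofReal_inv_of_pos (ENNReal.toReal_pos hcF0 hcFt), ENNReal.ofReal_toReal hcEt,
    ENNReal.ofReal_toReal hcFt] at key
  calc _ = (cE⁻¹ * cF⁻¹ *
        ENNReal.ofReal (∫ p, U p.1 p.2 ∂((ν.restrict E).prod (ν.restrict F)))) * (cE * cF) := by
        rw [← ENNReal.mul_inv (Or.inl hcE0) (Or.inl hcEt), mul_right_comm,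
          ENNReal.inv_mul_cancel (mul_ne_zero hcE0 hcF0) (ENNReal.mul_ne_top hcEt hcFt), one_mul]
    _ ≤ _ := by gcongr

namespace Triple.IsNonneg

variable {Z : Type*} [MeasurableSpace Z] {𝕍 : Triple Z} {ν : Measure Z}

theorem _root_.Graphex.Triple.lintegral_W_le_norm1 (ν : Measure Z) :
    ∫⁻ p, ‖𝕍.W p.1 p.2‖ₑ ∂(ν.prod ν) ≤ 𝕍.norm1 ν := by
  rw [Triple.norm1, add_assoc]; exact le_self_add

theorem integrable_W (h : 𝕍.IsNonneg) (hf : 𝕍.norm1 ν < ∞) :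
    Integrable (fun p : Z × Z => 𝕍.W p.1 p.2) (ν.prod ν) :=
  ⟨h.measurable_W.aestronglyMeasurable, (lintegral_W_le_norm1 ν).trans_lt hf⟩

theorem _root_.Graphex.Triple.lintegral_S_le_norm1 (ν : Measure Z) : ∫⁻ x, ‖𝕍.S x‖ₑ ∂ν ≤ 𝕍.norm1 ν := by
  rw [Triple.norm1, two_mul]
  exact le_add_right (le_add_left le_self_add)

theorem toReal_norm1 (h : 𝕍.IsNonneg) (hf : 𝕍.norm1 ν < ∞) :
    (𝕍.norm1 ν).toReal = 𝕍.edgeDensity ν := by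
  have h1 := ((lintegral_W_le_norm1 ν).trans_lt hf).ne
  have h2 := ((lintegral_S_le_norm1 ν).trans_lt hf).ne
  rw [Triple.norm1, Triple.edgeDensity, ENNReal.toReal_add (by finiteness) (by finiteness),
    ENNReal.toReal_add (by finiteness) (by finiteness), ENNReal.toReal_mul, ENNReal.toReal_mul,
    ← integral_norm_eq_lintegral_enorm h.measurable_W.aestronglyMeasurable,
    ← integral_norm_eq_lintegral_enorm h.measurable_S.aestronglyMeasurable]
  simp [abs_of_nonneg, h.W_nonneg, h.S_nonneg, h.I_nonneg]

theorem ae_enorm_marginal [SFinite ν] (h : 𝕍.IsNonneg) (hf : 𝕍.norm1 ν < ∞) :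
    ∀ᵐ z ∂ν, ‖𝕍.marginal ν z‖ₑ = 𝕍.absMarginal ν z := by
  have h1 := ((lintegral_W_le_norm1 ν).trans_lt hf).ne
  rw [lintegral_prod _ h.measurable_enorm_W.aemeasurable] at h1
  filter_upwards [ae_lt_top (h.measurable_lintegral_W ν) h1] with z hz
  have hm : Measurable (𝕍.W z) := h.measurable_W.comp (measurable_prodMk_left (x := z))
  have h0 : 0 ≤ ∫ y, 𝕍.W z y ∂ν := integral_nonneg fun y => h.W_nonneg z y
  rw [Triple.marginal, Triple.absMarginal, Real.enorm_of_nonneg (add_nonneg h0 (h.S_nonneg z)),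
    ENNReal.ofReal_add h0 (h.S_nonneg z), Real.enorm_of_nonneg (h.S_nonneg z),
    ofReal_integral_eq_lintegral_ofReal ⟨hm.aestronglyMeasurable, hz⟩
      (ae_of_all _ fun y => h.W_nonneg z y)]
  simp_rw [fun y => Real.enorm_of_nonneg (h.W_nonneg z y)]

theorem measurable_marginal [SFinite ν] (h : 𝕍.IsNonneg) : Measurable (𝕍.marginal ν) :=
  h.measurable_W.stronglyMeasurable.integral_prod_right'.measurable.add h.measurable_S

end Triple.IsNonneg

theorem isClose_of_d22_le {Z : Type*} [MeasurableSpace Z] {𝕍₁ 𝕍₂ : Triple Z} {ν : Measure Z}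
    [SFinite ν] {ε : ℝ≥0∞} (h₁ : 𝕍₁.IsNonneg) (h₂ : 𝕍₂.IsNonneg) (hf₁ : 𝕍₁.norm1 ν < ∞)
    (hf₂ : 𝕍₂.norm1 ν < ∞) (h : d22 𝕍₁ 𝕍₂ ν ≤ ε) : IsClose 𝕍₁ 𝕍₂ ν ε := by
  rw [d22, max_le_iff, max_le_iff] at h
  obtain ⟨hW, hD, hρ⟩ := h
  refine ⟨fun E F hE hF hEf hFf => ?_, fun E hE => ?_, ?_⟩
  · have hle : (ν.restrict E).prod (ν.restrict F) ≤ ν.prod ν := by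
      rw [Measure.prod_restrict]; exact Measure.restrict_le_self
    have i1 := (h₁.integrable_W hf₁).mono_measure hle
    have i2 := (h₂.integrable_W hf₂).mono_measure hle
    have key := (ofReal_integral_rect_le_kernelNorm_mul (U := fun x y => 𝕍₁.W x y - 𝕍₂.W x y) hE hF hEf.ne
      hFf.ne).trans (mul_le_mul_left hW _)
    refine le_add_of_ofReal_sub_le i2.2.ne i1.2.ne (le_trans (le_of_eq ?_) key)
    rw [integral_sub i1 i2, ← integral_norm_eq_lintegral_enorm i1.1,
      ← integral_norm_eq_lintegral_enorm i2.1]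
    simp [abs_of_nonneg, h₁.W_nonneg, h₂.W_nonneg]
  · have hD' : eLpNorm (fun x => 𝕍₁.marginal ν x - 𝕍₂.marginal ν x) 2 ν ≤ ε ^ 2 := by
      have := ENNReal.rpow_le_rpow hD (show (0 : ℝ) ≤ 2 by norm_num)
      rwa [← ENNReal.rpow_mul, show (1 / 2 * 2 : ℝ) = 1 by norm_num, ENNReal.rpow_one,
        ENNReal.rpow_ofNat] at this
    have hm : Measurable (fun x => 𝕍₁.marginal ν x - 𝕍₂.marginal ν x) :=
      h₁.measurable_marginal.sub h₂.measurable_marginal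
    have hcs := eLpNorm_le_eLpNorm_mul_rpow_measure_univ (μ := ν.restrict E) (p := 1) (q := 2)
      (by norm_num) hm.aestronglyMeasurable
    rw [eLpNorm_one_eq_lintegral_enorm, Measure.restrict_apply_univ] at hcs
    have hcs' : ∫⁻ x in E, ‖𝕍₁.marginal ν x - 𝕍₂.marginal ν x‖ₑ ∂ν ≤
        ε ^ 2 * ν E ^ (1 / 2 : ℝ) := by
      refine hcs.trans ?_
      rw [show (1 / (1 : ℝ≥0∞).toReal - 1 / (2 : ℝ≥0∞).toReal) = (1 / 2 : ℝ) by norm_num]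
      gcongr
      exact (eLpNorm_mono_measure _ Measure.restrict_le_self).trans hD'
    calc ∫⁻ z in E, 𝕍₁.absMarginal ν z ∂ν
        ≤ ∫⁻ z in E, (𝕍₂.absMarginal ν z + ‖𝕍₁.marginal ν z - 𝕍₂.marginal ν z‖ₑ) ∂ν := by
          refine lintegral_mono_ae (ae_restrict_of_ae ?_)
          filter_upwards [h₁.ae_enorm_marginal hf₁, h₂.ae_enorm_marginal hf₂] with z e1 e2
          rw [← e1, ← e2]
          calc _ = ‖𝕍₂.marginal ν z + (𝕍₁.marginal ν z - 𝕍₂.marginal ν z)‖ₑ := by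
                congr 1; ring
            _ ≤ _ := enorm_add_le _ _
      _ ≤ _ := by
          rw [lintegral_add_left (h₂.measurable_absMarginal ν)]
          gcongr
  · refine le_add_of_ofReal_sub_le hf₂.ne hf₁.ne ?_
    rw [h₁.toReal_norm1 hf₁, h₂.toReal_norm1 hf₂]
    refine (ENNReal.ofReal_le_ofReal (le_abs_self _)).trans ?_
    have := ENNReal.rpow_le_rpow hρ (show (0 : ℝ) ≤ 3 by norm_num)
    rwa [← ENNReal.rpow_mul, show (1 / 3 * 3 : ℝ) = 1 by norm_num, ENNReal.rpow_one,
        ENNReal.rpow_ofNat] at this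

theorem kernelNorm_neg_le {Z : Type*} [MeasurableSpace Z] (U : Z → Z → ℝ) (ν : Measure Z) :
    kernelNorm (fun x y => -U x y) ν ≤ kernelNorm U ν := by
  unfold kernelNorm
  refine iSup_le fun f => iSup_le fun g => iSup_le fun hf => iSup_le fun hg => iSup_le fun hf1 =>
    iSup_le fun hg1 => ?_
  refine le_iSup_of_le (-f) (le_iSup_of_le g (le_iSup_of_le hf.neg (le_iSup_of_le hg
    (le_iSup_of_le (by rwa [eLpNorm_neg]) (le_iSup_of_le hg1 (le_of_eq ?_))))))
  simp

theorem d22_swap_le {Z : Type*} [MeasurableSpace Z] (𝕍₁ 𝕍₂ : Triple Z) (ν : Measure Z) :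
    d22 𝕍₂ 𝕍₁ ν ≤ d22 𝕍₁ 𝕍₂ ν := by
  unfold d22
  refine max_le_max ?_ (max_le_max (le_of_eq ?_) (le_of_eq ?_))
  · simpa using kernelNorm_neg_le (fun x y => 𝕍₁.W x y - 𝕍₂.W x y) ν
  · congr 1
    rw [← eLpNorm_neg]
    congr 1; ext x; simp
  · rw [abs_sub_comm]

theorem Triple.MemL1L2.norm1_lt_top {Ω : Type*} [MeasurableSpace Ω] {𝕎 : Triple Ω}
    {μ : Measure Ω} (h : 𝕎.MemL1L2 μ) : 𝕎.norm1 μ < ∞ := by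
  have h1 : ∫⁻ p, ‖𝕎.W p.1 p.2‖ₑ ∂(μ.prod μ) < ∞ := by
    simpa [eLpNorm_one_eq_lintegral_enorm] using h.memLp_W_one.2
  have h2 : ∫⁻ x, ‖𝕎.S x‖ₑ ∂μ < ∞ := by
    refine lt_of_le_of_lt (lintegral_mono fun x => ?_)
      (eLpNorm_one_eq_lintegral_enorm (f := 𝕎.absMarginal μ) ▸ h.memLp_D_one.2)
    exact le_add_left le_rfl
  rw [Triple.norm1]
  finiteness

/-! ### Lifted marginals and total masses -/

section Lift

variable {Ω Z : Type*} [MeasurableSpace Ω] [MeasurableSpace Z] {𝕎 : Triple Ω}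
    {μ μ' : Measure Ω} {ν : Measure Z} {π : Z → Ω ⊕ ℝ} {ε : ℝ≥0∞}

theorem IsLift.comap_eq (h : IsLift 𝕎 μ μ' ν π ε) : (ν.map π).comap Sum.inl = μ' := by
  rw [h.map_eq, comap_inl_extendMeasure]

theorem IsLift.measure_preimage (h : IsLift 𝕎 μ μ' ν π ε) {A : Set Ω} (hA : MeasurableSet A) :
    ν (π ⁻¹' (Sum.inl '' A)) = μ' A := by
  rw [← Measure.map_apply h.measurable hA.inl_image, ← measurableEmbedding_inl.comap_apply,
    h.comap_eq]

/-- The real line carries no mass of the extended triple, so restricting `ν` over `A` amounts to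
restricting `μ'` to the part of `A` in `Ω`. -/
theorem IsLift.norm1_restrict (h : IsLift 𝕎 μ μ' ν π ε) (hn : 𝕎.IsNonneg) [SigmaFinite ν]
    [SigmaFinite μ'] {A : Set (Ω ⊕ ℝ)} (hA : MeasurableSet A) :
    (𝕎.extend.pullback π).norm1 (ν.restrict (π ⁻¹' A)) =
      𝕎.norm1 (μ'.restrict (Sum.inl ⁻¹' A)) := by
  have e1 : ((ν.map π).restrict A).comap Sum.inl = μ'.restrict (Sum.inl ⁻¹' A) := by
    ext B hB
    rw [measurableEmbedding_inl.comap_apply, Measure.restrict_apply hB.inl_image,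
      Measure.restrict_apply hB, ← image_inter_preimage, ← measurableEmbedding_inl.comap_apply,
      h.comap_eq]
  have e2 : (ν.restrict (π ⁻¹' A)).map π = (ν.map π).restrict A :=
    (Measure.restrict_map h.measurable hA).symm
  have : SFinite (((ν.map π).restrict A).comap Sum.inl) := by rw [e1]; infer_instance
  rw [hn.extend.norm1_pullback h.measurable, e2, hn.norm1_extend, e1]

theorem IsLift.norm1_eq (h : IsLift 𝕎 μ μ' ν π ε) (hn : 𝕎.IsNonneg) [SigmaFinite ν]
    [SigmaFinite μ'] : (𝕎.extend.pullback π).norm1 ν = 𝕎.norm1 μ' := by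
  simpa using h.norm1_restrict hn (MeasurableSet.univ (α := Ω ⊕ ℝ))

theorem IsLift.absMarginal_eq (h : IsLift 𝕎 μ μ' ν π ε) (hn : 𝕎.IsNonneg) (z : Z) :
    (𝕎.extend.pullback π).absMarginal ν z = Sum.elim (𝕎.absMarginal μ') (fun _ => 0) (π z) := by
  rw [hn.extend.absMarginal_pullback h.measurable, Triple.absMarginal_extend, h.comap_eq]

/-- The marginal of the trivial extension of `𝕎` with respect to `μ`, pulled back along `π`. -/
def liftMarginal (𝕎 : Triple Ω) (μ : Measure Ω) (π : Z → Ω ⊕ ℝ) (z : Z) : ℝ≥0∞ :=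
  Sum.elim (𝕎.absMarginal μ) (fun _ => 0) (π z)

theorem measurable_liftMarginal (hn : 𝕎.IsNonneg) (μ : Measure Ω) [SFinite μ]
    (hπ : Measurable π) : Measurable (liftMarginal 𝕎 μ π) :=
  ((hn.measurable_absMarginal μ).sumElim measurable_const).comp hπ

theorem absMarginal_le_of_near (hn : 𝕎.IsNonneg) (hW : ∀ x y, 𝕎.W x y ≤ 1)
    {r : ℝ≥0∞} (h : IsNearSubmeasure μ' μ r) (x : Ω) :
    𝕎.absMarginal μ x ≤ 𝕎.absMarginal μ' x + r := by
  have := h.lintegral_le (f := fun y => ‖𝕎.W x y‖ₑ)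
    (hn.measurable_W.comp (measurable_prodMk_left (x := x))).enorm (fun y => by
      rw [Real.enorm_of_nonneg (hn.W_nonneg x y)]; simpa using hW x y)
  rw [Triple.absMarginal, Triple.absMarginal, add_right_comm]
  gcongr

theorem IsLift.liftMarginal_le (h : IsLift 𝕎 μ μ' ν π ε) (hn : 𝕎.IsNonneg)
    (hW : ∀ x y, 𝕎.W x y ≤ 1) (z : Z) :
    liftMarginal 𝕎 μ π z ≤ (𝕎.extend.pullback π).absMarginal ν z + ε ^ 2 := by
  rw [h.absMarginal_eq hn, liftMarginal]
  rcases π z with x | t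
  · exact absMarginal_le_of_near hn hW h.near x
  · simp

theorem IsLift.le_liftMarginal (h : IsLift 𝕎 μ μ' ν π ε) (hn : 𝕎.IsNonneg) (z : Z) :
    (𝕎.extend.pullback π).absMarginal ν z ≤ liftMarginal 𝕎 μ π z := by
  rw [h.absMarginal_eq hn, liftMarginal]
  rcases π z with x | t
  · simp only [Sum.elim_inl, Triple.absMarginal]
    gcongr
    exact h.near.le
  · simp

theorem IsLift.measure_lt_liftMarginal (h : IsLift 𝕎 μ μ' ν π ε) (hn : 𝕎.IsNonneg) [SFinite μ]
    (b : ℝ≥0∞) : ν {z | b < liftMarginal 𝕎 μ π z} = μ' {x | b < 𝕎.absMarginal μ x} := by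
  rw [← h.measure_preimage (measurableSet_lt measurable_const (hn.measurable_absMarginal μ))]
  congr 1
  ext z
  simp only [mem_ofPred_eq, mem_preimage, mem_image, liftMarginal]
  rcases π z with x | t <;> simp

theorem measure_lt_absMarginal_lt_top (hn : 𝕎.IsNonneg) (hW : ∀ x y, 𝕎.W x y ≤ 1)
    [SigmaFinite μ] [SigmaFinite μ'] {r b : ℝ≥0∞} (h : IsNearSubmeasure μ' μ r)
    (hf : 𝕎.norm1 μ' < ∞) (hrb : r < b) : μ {x | b < 𝕎.absMarginal μ x} < ∞ := by
  have hr : r ≠ ∞ := hrb.ne_top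
  have hm := measurableSet_lt (measurable_const (a := b)) (hn.measurable_absMarginal μ)
  refine (h _ hm).1.trans_lt (ENNReal.add_lt_top.2 ⟨?_, hr.lt_top⟩)
  refine lt_of_le_of_lt (measure_mono (t := {x | b - r ≤ 𝕎.absMarginal μ' x}) fun x hx =>
    tsub_le_iff_right.2 (hx.le.trans (absMarginal_le_of_near hn hW h x))) ?_
  refine ENNReal.lt_top_of_mul_ne_top_right (a := b - r) ?_ (tsub_pos_of_lt hrb).ne'
  exact ((mul_meas_ge_le_lintegral (hn.measurable_absMarginal μ') _).trans_lt
    ((hn.lintegral_absMarginal_le_norm1 μ').trans_lt hf)).ne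

/-- Off the points of marginal greater than `1`, passing to a submeasure of small defect changes the
total mass by little. -/
theorem norm1_restrict_le_of_near (hn : 𝕎.IsNonneg) [SigmaFinite μ] [SigmaFinite μ']
    {r : ℝ≥0∞} (h : IsNearSubmeasure μ' μ r) :
    𝕎.norm1 (μ.restrict {x | 𝕎.absMarginal μ x ≤ 1}) ≤
      𝕎.norm1 (μ'.restrict {x | 𝕎.absMarginal μ x ≤ 1}) + 4 * r := by
  set A := {x | 𝕎.absMarginal μ x ≤ 1} with hAdef
  have hA : MeasurableSet A := measurableSet_le (hn.measurable_absMarginal μ) measurable_const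
  have hnear : ∀ f : Ω → ℝ≥0∞, Measurable f → (∀ x ∈ A, f x ≤ 1) →
      ∫⁻ x in A, f x ∂μ ≤ ∫⁻ x in A, f x ∂μ' + r := by
    intro f hf h1
    rw [← lintegral_indicator hA, ← lintegral_indicator hA]
    refine h.lintegral_le (hf.indicator hA) fun x => ?_
    by_cases hx : x ∈ A <;> simp [hx, h1]
  have hrow : ∀ x ∈ A, ∫⁻ y in A, ‖𝕎.W x y‖ₑ ∂μ ≤ 1 := fun x hx =>
    (setLIntegral_le_lintegral _ _).trans ((le_add_right le_rfl).trans hx)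
  have hS : ∫⁻ x in A, ‖𝕎.S x‖ₑ ∂μ ≤ ∫⁻ x in A, ‖𝕎.S x‖ₑ ∂μ' + r :=
    hnear _ hn.measurable_S.enorm fun x hx => (le_add_left le_rfl).trans hx
  have hcol : ∀ y ∈ A, ∫⁻ x in A, ‖𝕎.W x y‖ₑ ∂μ' ≤ 1 := fun y hy => by
    refine le_trans ?_ (hrow y hy)
    simp_rw [hn.symm_W _ y]
    exact lintegral_mono' (Measure.restrict_mono le_rfl h.le) le_rfl
  have hW : ∫⁻ p, ‖𝕎.W p.1 p.2‖ₑ ∂((μ.restrict A).prod (μ.restrict A)) ≤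
      ∫⁻ p, ‖𝕎.W p.1 p.2‖ₑ ∂((μ'.restrict A).prod (μ'.restrict A)) + 2 * r := by
    -- one variable at a time is passed to `μ'`, using that all sections are bounded by `1` on `A`
    rw [lintegral_prod _ hn.measurable_enorm_W.aemeasurable,
      lintegral_prod_symm _ hn.measurable_enorm_W.aemeasurable]
    calc _ ≤ ∫⁻ x in A, ∫⁻ y in A, ‖𝕎.W x y‖ₑ ∂μ ∂μ' + r :=
          hnear _ (hn.measurable_lintegral_W _) hrow
      _ = ∫⁻ y in A, ∫⁻ x in A, ‖𝕎.W x y‖ₑ ∂μ' ∂μ + r := by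
          rw [lintegral_lintegral_swap hn.measurable_enorm_W.aemeasurable]
      _ ≤ (∫⁻ y in A, ∫⁻ x in A, ‖𝕎.W x y‖ₑ ∂μ' ∂μ' + r) + r := by
          gcongr
          exact hnear _ hn.measurable_enorm_W.lintegral_prod_left' hcol
      _ = _ := by rw [add_assoc, two_mul]
  rw [Triple.norm1, Triple.norm1]
  calc _ ≤ (∫⁻ p, ‖𝕎.W p.1 p.2‖ₑ ∂((μ'.restrict A).prod (μ'.restrict A)) + 2 * r) +
        2 * (∫⁻ x in A, ‖𝕎.S x‖ₑ ∂μ' + r) + 2 * ‖𝕎.I‖ₑ := by gcongr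
    _ = _ := by ring

end Lift

theorem exists_isLift_isClose {Ω₁ Ω₂ : Type*} [MeasurableSpace Ω₁] [MeasurableSpace Ω₂]
    {μ₁ : Measure Ω₁} {μ₂ : Measure Ω₂} {𝕎₁ : Triple Ω₁} {𝕎₂ : Triple Ω₂}
    (h₁ : IsGraphex 𝕎₁ μ₁) (h₂ : IsGraphex 𝕎₂ μ₂) (hδ : weakKernelDist 𝕎₁ μ₁ 𝕎₂ μ₂ = 0)
    {ε : ℝ≥0∞} (hε : 0 < ε) :
    ∃ (μ₁' : Measure Ω₁) (μ₂' : Measure Ω₂) (ν : Measure ((Ω₁ ⊕ ℝ) × (Ω₂ ⊕ ℝ))),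
      SigmaFinite ν ∧ IsLift 𝕎₁ μ₁ μ₁' ν Prod.fst ε ∧ IsLift 𝕎₂ μ₂ μ₂' ν Prod.snd ε ∧
      IsClose (𝕎₁.extend.pullback Prod.fst) (𝕎₂.extend.pullback Prod.snd) ν ε ∧
      IsClose (𝕎₂.extend.pullback Prod.snd) (𝕎₁.extend.pullback Prod.fst) ν ε := by
  have := h₁.sigmaFinite
  have := h₂.sigmaFinite
  obtain ⟨c, ⟨μ₁', μ₂', hm₁, hm₂, hn₁, hn₂, hd⟩, hc⟩ :
      ∃ (c : ℝ≥0) (_ : ∃ (μ₁' : Measure Ω₁) (μ₂' : Measure Ω₂),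
        𝕎₁.MemL1L2 μ₁' ∧ 𝕎₂.MemL1L2 μ₂' ∧
        IsNearSubmeasure μ₁' μ₁ ((c : ℝ≥0∞) ^ 2) ∧ IsNearSubmeasure μ₂' μ₂ ((c : ℝ≥0∞) ^ 2) ∧
        kernelDist 𝕎₁ μ₁' 𝕎₂ μ₂' ≤ c), (c : ℝ≥0∞) < ε := by
    rw [← hδ, weakKernelDist] at hε
    simpa only [iInf_lt_iff] using hε
  have hd' := hd.trans_lt hc
  rw [kernelDist, couplingDist] at hd'
  simp only [iInf_lt_iff] at hd'
  obtain ⟨ν, ⟨hν₁, hν₂⟩, hν⟩ := hd'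
  have hs₁ : SigmaFinite μ₁' := Measure.sigmaFinite_of_le μ₁ hn₁.le
  have hs₂ : SigmaFinite μ₂' := Measure.sigmaFinite_of_le μ₂ hn₂.le
  have hs : SigmaFinite ν := by
    refine SigmaFinite.of_map ν measurable_fst.aemeasurable ?_
    rw [hν₁]; infer_instance
  have hcε : (c : ℝ≥0∞) ^ 2 ≤ ε ^ 2 := by gcongr
  have l₁ : IsLift 𝕎₁ μ₁ μ₁' ν Prod.fst ε := ⟨measurable_fst, hν₁,
    fun B hB => ⟨(hn₁ B hB).1.trans (by gcongr), (hn₁ B hB).2⟩,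
    hm₁.norm1_lt_top⟩
  have l₂ : IsLift 𝕎₂ μ₂ μ₂' ν Prod.snd ε := ⟨measurable_snd, hν₂,
    fun B hB => ⟨(hn₂ B hB).1.trans (by gcongr), (hn₂ B hB).2⟩,
    hm₂.norm1_lt_top⟩
  have p₁ := h₁.isNonneg.extend.pullback (measurable_fst (α := Ω₁ ⊕ ℝ) (β := Ω₂ ⊕ ℝ))
  have p₂ := h₂.isNonneg.extend.pullback (measurable_snd (α := Ω₁ ⊕ ℝ) (β := Ω₂ ⊕ ℝ))
  have f₁ := (l₁.norm1_eq h₁.isNonneg).trans_lt l₁.norm1_lt_top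
  have f₂ := (l₂.norm1_eq h₂.isNonneg).trans_lt l₂.norm1_lt_top
  exact ⟨μ₁', μ₂', ν, hs, l₁, l₂, isClose_of_d22_le p₁ p₂ f₁ f₂ hν.le,
    isClose_of_d22_le p₂ p₁ f₂ f₁ ((d22_swap_le _ _ _).trans hν.le)⟩

/-! ### Consequences of closeness -/

namespace Triple.IsNonneg

variable {Z : Type*} [MeasurableSpace Z] {𝕍 : Triple Z}

theorem lintegral_W_swap (h : 𝕍.IsNonneg) (a b : Measure Z) [SFinite a] [SFinite b] :
    ∫⁻ p, ‖𝕍.W p.1 p.2‖ₑ ∂(a.prod b) = ∫⁻ p, ‖𝕍.W p.1 p.2‖ₑ ∂(b.prod a) := by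
  rw [← lintegral_prod_swap]
  exact lintegral_congr fun p => by rw [Prod.fst_swap, Prod.snd_swap, h.symm_W]

theorem setLIntegral_absMarginal (h : 𝕍.IsNonneg) (ν : Measure Z) [SFinite ν] (E : Set Z) :
    ∫⁻ z in E, 𝕍.absMarginal ν z ∂ν =
      ∫⁻ p, ‖𝕍.W p.1 p.2‖ₑ ∂((ν.restrict E).prod ν) + ∫⁻ z in E, ‖𝕍.S z‖ₑ ∂ν := by
  rw [lintegral_prod _ h.measurable_enorm_W.aemeasurable,
    ← lintegral_add_left (h.measurable_lintegral_W ν)]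
  rfl

theorem norm1_add (h : 𝕍.IsNonneg) (a b : Measure Z) [SFinite a] [SFinite b] :
    𝕍.norm1 (a + b) = 𝕍.norm1 a + (2 * ∫⁻ p, ‖𝕍.W p.1 p.2‖ₑ ∂(b.prod a) +
      ∫⁻ p, ‖𝕍.W p.1 p.2‖ₑ ∂(b.prod b) + 2 * ∫⁻ z, ‖𝕍.S z‖ₑ ∂b) := by
  simp only [Triple.norm1, Measure.prod_add, Measure.add_prod, lintegral_add_measure]
  rw [h.lintegral_W_swap a b]
  ring

/-- Removing `E` from a triple lowers its total mass by twice the mass of the marginal on `E`, up to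
the part of `W` on `E × E` that is then removed twice. -/
theorem norm1_add_lintegral_prod (h : 𝕍.IsNonneg) (ν : Measure Z) [SFinite ν] {E : Set Z}
    (hE : MeasurableSet E) :
    𝕍.norm1 ν + ∫⁻ p, ‖𝕍.W p.1 p.2‖ₑ ∂((ν.restrict E).prod (ν.restrict E)) =
      𝕍.norm1 (ν.restrict Eᶜ) + 2 * ∫⁻ z in E, 𝕍.absMarginal ν z ∂ν := by
  have hν : ν.restrict Eᶜ + ν.restrict E = ν := by
    rw [add_comm]; exact Measure.restrict_add_restrict_compl hE
  have e1 := h.norm1_add (ν.restrict Eᶜ) (ν.restrict E)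
  have e2 : ∫⁻ p, ‖𝕍.W p.1 p.2‖ₑ ∂((ν.restrict E).prod ν) =
      ∫⁻ p, ‖𝕍.W p.1 p.2‖ₑ ∂((ν.restrict E).prod (ν.restrict Eᶜ)) +
      ∫⁻ p, ‖𝕍.W p.1 p.2‖ₑ ∂((ν.restrict E).prod (ν.restrict E)) := by
    rw [← lintegral_add_measure, ← Measure.prod_add, hν]
  rw [hν] at e1
  rw [h.setLIntegral_absMarginal, e2, e1]
  ring

theorem norm1_restrict_union_le (h : 𝕍.IsNonneg) (ν : Measure Z) [SFinite ν] {A F : Set Z}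
    (hF : MeasurableSet F) (hd : Disjoint A F) :
    𝕍.norm1 (ν.restrict (A ∪ F)) ≤
      𝕍.norm1 (ν.restrict A) + 2 * ∫⁻ z in F, 𝕍.absMarginal ν z ∂ν := by
  rw [Measure.restrict_union hd hF, h.norm1_add, h.setLIntegral_absMarginal]
  have e : ∫⁻ p, ‖𝕍.W p.1 p.2‖ₑ ∂((ν.restrict F).prod (ν.restrict A)) +
      ∫⁻ p, ‖𝕍.W p.1 p.2‖ₑ ∂((ν.restrict F).prod (ν.restrict F)) ≤
      ∫⁻ p, ‖𝕍.W p.1 p.2‖ₑ ∂((ν.restrict F).prod ν) := by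
    rw [← lintegral_add_measure, ← Measure.prod_add, ← Measure.restrict_union hd hF]
    exact lintegral_mono' (Measure.prod_mono le_rfl Measure.restrict_le_self) le_rfl
  gcongr 𝕍.norm1 (ν.restrict A) + ?_
  rw [mul_add]
  gcongr ?_ + _
  refine le_trans ?_ (mul_le_mul_right e 2)
  rw [mul_add]
  gcongr
  exact le_mul_of_one_le_left zero_le one_le_two

end Triple.IsNonneg

section Close

variable {Z : Type*} [MeasurableSpace Z] {𝕍₁ 𝕍₂ : Triple Z} {ν : Measure Z} {ε : ℝ≥0∞}

/-- The error in comparing total masses off a set of measure at most `C`. -/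
theorem IsClose.norm1_compl_le [SFinite ν] (h₁₂ : IsClose 𝕍₁ 𝕍₂ ν ε) (h₂₁ : IsClose 𝕍₂ 𝕍₁ ν ε)
    (h₁ : 𝕍₁.IsNonneg) (h₂ : 𝕍₂.IsNonneg) (hf : 𝕍₁.norm1 ν < ∞) {E : Set Z}
    (hE : MeasurableSet E) (hEf : ν E < ∞) :
    𝕍₁.norm1 (ν.restrict Eᶜ) ≤ 𝕍₂.norm1 (ν.restrict Eᶜ) +
      (ε ^ 3 + ε * ν E + 2 * (ε ^ 2 * ν E ^ (1 / 2 : ℝ))) := by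
  have hfin : 2 * ∫⁻ z in E, 𝕍₁.absMarginal ν z ∂ν ≠ ∞ :=
    ENNReal.mul_ne_top (by norm_num) ((setLIntegral_le_lintegral _ _).trans_lt
      ((h₁.lintegral_absMarginal_le_norm1 ν).trans_lt hf)).ne
  have hsq : ν E ^ (1 / 2 : ℝ) * ν E ^ (1 / 2 : ℝ) = ν E := by
    rw [← ENNReal.rpow_add_of_nonneg _ _ (by norm_num) (by norm_num)]; norm_num
  have hW := h₁₂.W_le E E hE hE hEf hEf
  rw [hsq] at hW
  refine (ENNReal.add_le_add_iff_right hfin).1 ?_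
  calc 𝕍₁.norm1 (ν.restrict Eᶜ) + 2 * ∫⁻ z in E, 𝕍₁.absMarginal ν z ∂ν
      = 𝕍₁.norm1 ν + ∫⁻ p, ‖𝕍₁.W p.1 p.2‖ₑ ∂((ν.restrict E).prod (ν.restrict E)) :=
        (h₁.norm1_add_lintegral_prod ν hE).symm
    _ ≤ (𝕍₂.norm1 ν + ε ^ 3) +
        (∫⁻ p, ‖𝕍₂.W p.1 p.2‖ₑ ∂((ν.restrict E).prod (ν.restrict E)) + ε * ν E) :=
        add_le_add h₁₂.norm1_le hW
    _ = (𝕍₂.norm1 (ν.restrict Eᶜ) + 2 * ∫⁻ z in E, 𝕍₂.absMarginal ν z ∂ν) +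
        (ε ^ 3 + ε * ν E) := by
        rw [← h₂.norm1_add_lintegral_prod ν hE]; ring
    _ ≤ (𝕍₂.norm1 (ν.restrict Eᶜ) + 2 * (∫⁻ z in E, 𝕍₁.absMarginal ν z ∂ν +
        ε ^ 2 * ν E ^ (1 / 2 : ℝ))) + (ε ^ 3 + ε * ν E) := by
        gcongr; exact h₂₁.D_le E hE
    _ = _ := by ring

/-- Close triples have few points at which one marginal exceeds `b` while the other is at most
`a`. -/
theorem IsClose.mul_measure_le (h : IsClose 𝕍₁ 𝕍₂ ν ε) {d₁ d₂ : Z → ℝ≥0∞}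
    (hm₁ : Measurable d₁) (hm₂ : Measurable d₂) (hd₁ : ∀ z, d₁ z ≤ 𝕍₁.absMarginal ν z + ε ^ 2)
    (hd₂ : ∀ z, 𝕍₂.absMarginal ν z ≤ d₂ z) (a b : ℝ≥0∞) :
    b * ν {z | b < d₁ z ∧ d₂ z ≤ a} ≤ a * ν {z | b < d₁ z ∧ d₂ z ≤ a} +
      ε ^ 2 * (ν {z | b < d₁ z ∧ d₂ z ≤ a} ^ (1 / 2 : ℝ) + ν {z | b < d₁ z ∧ d₂ z ≤ a}) := by
  set E := {z | b < d₁ z ∧ d₂ z ≤ a}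
  have hE : MeasurableSet E :=
    (measurableSet_lt measurable_const hm₁).inter (measurableSet_le hm₂ measurable_const)
  calc b * ν E = ∫⁻ _ in E, b ∂ν := by simp
    _ ≤ ∫⁻ z in E, (𝕍₁.absMarginal ν z + ε ^ 2) ∂ν :=
        setLIntegral_mono' hE fun z hz => hz.1.le.trans (hd₁ z)
    _ = ∫⁻ z in E, 𝕍₁.absMarginal ν z ∂ν + ε ^ 2 * ν E := by
        rw [lintegral_add_right _ measurable_const]; simp
    _ ≤ (∫⁻ z in E, 𝕍₂.absMarginal ν z ∂ν + ε ^ 2 * ν E ^ (1 / 2 : ℝ)) + ε ^ 2 * ν E := by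
        gcongr; exact h.D_le E hE
    _ ≤ (∫⁻ _ in E, a ∂ν + ε ^ 2 * ν E ^ (1 / 2 : ℝ)) + ε ^ 2 * ν E := by
        gcongr ?_ + _ + _
        exact setLIntegral_mono' hE fun z hz => (hd₂ z).trans hz.2
    _ = _ := by simp only [lintegral_const, Measure.restrict_apply_univ]; ring

end Close

theorem Triple.norm1_mono {Ω : Type*} [MeasurableSpace Ω] (𝕎 : Triple Ω) {a b : Measure Ω}
    [SFinite a] [SFinite b] (hab : a ≤ b) : 𝕎.norm1 a ≤ 𝕎.norm1 b := by
  have := Measure.prod_mono hab hab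
  unfold Triple.norm1
  gcongr

theorem measurableSet_elim_absMarginal_le {Ω : Type*} [MeasurableSpace Ω] {𝕎 : Triple Ω}
    (hn : 𝕎.IsNonneg) (μ : Measure Ω) [SFinite μ] :
    MeasurableSet {p : Ω ⊕ ℝ | Sum.elim (𝕎.absMarginal μ) (fun _ => 0) p ≤ 1} :=
  measurableSet_le ((hn.measurable_absMarginal μ).sumElim measurable_const) measurable_const

/-- The total masses off the points of marginal greater than `1` differ by an error that is small
once `ν` charges little the points where the first marginal is at most `1` and the second is not. -/
theorem norm1_restrict_le_of_isClose {Ω₁ Ω₂ Z : Type*} [MeasurableSpace Ω₁] [MeasurableSpace Ω₂]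
    [MeasurableSpace Z] {𝕎₁ : Triple Ω₁} {𝕎₂ : Triple Ω₂} {μ₁ μ₁' : Measure Ω₁}
    {μ₂ μ₂' : Measure Ω₂} {ν : Measure Z} {π₁ : Z → Ω₁ ⊕ ℝ} {π₂ : Z → Ω₂ ⊕ ℝ} {ε C : ℝ≥0∞}
    [SigmaFinite μ₁] [SigmaFinite μ₂] [SigmaFinite ν] (hn₁ : 𝕎₁.IsNonneg) (hn₂ : 𝕎₂.IsNonneg)
    (l₁ : IsLift 𝕎₁ μ₁ μ₁' ν π₁ ε) (l₂ : IsLift 𝕎₂ μ₂ μ₂' ν π₂ ε)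
    (h₁₂ : IsClose (𝕎₁.extend.pullback π₁) (𝕎₂.extend.pullback π₂) ν ε)
    (h₂₁ : IsClose (𝕎₂.extend.pullback π₂) (𝕎₁.extend.pullback π₁) ν ε)
    (hC : μ₂ {x | 1 < 𝕎₂.absMarginal μ₂ x} ≤ C) (hCf : C < ∞) :
    𝕎₁.norm1 (μ₁.restrict {x | 𝕎₁.absMarginal μ₁ x ≤ 1}) ≤
      𝕎₂.norm1 (μ₂.restrict {x | 𝕎₂.absMarginal μ₂ x ≤ 1}) +
        (4 * ε ^ 2 + (ε ^ 3 + ε * C + 2 * (ε ^ 2 * C ^ (1 / 2 : ℝ))) +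
        2 * (ν {z | 1 < liftMarginal 𝕎₂ μ₂ π₂ z ∧ liftMarginal 𝕎₁ μ₁ π₁ z ≤ 1} +
          ε ^ 2 * C ^ (1 / 2 : ℝ))) := by
  have hs₁ : SigmaFinite μ₁' := Measure.sigmaFinite_of_le μ₁ l₁.near.le
  have hs₂ : SigmaFinite μ₂' := Measure.sigmaFinite_of_le μ₂ l₂.near.le
  have p₁ := hn₁.extend.pullback l₁.measurable
  have p₂ := hn₂.extend.pullback l₂.measurable
  have m₁ := measurable_liftMarginal hn₁ μ₁ l₁.measurable
  have m₂ := measurable_liftMarginal hn₂ μ₂ l₂.measurable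
  set d₁ := liftMarginal 𝕎₁ μ₁ π₁ with hd₁
  set d₂ := liftMarginal 𝕎₂ μ₂ π₂ with hd₂
  have r₁ : (𝕎₁.extend.pullback π₁).norm1 (ν.restrict {z | d₁ z ≤ 1}) =
      𝕎₁.norm1 (μ₁'.restrict {x | 𝕎₁.absMarginal μ₁ x ≤ 1}) :=
    l₁.norm1_restrict hn₁ (measurableSet_elim_absMarginal_le hn₁ μ₁)
  have r₂ : (𝕎₂.extend.pullback π₂).norm1 (ν.restrict {z | d₂ z ≤ 1}) =
      𝕎₂.norm1 (μ₂'.restrict {x | 𝕎₂.absMarginal μ₂ x ≤ 1}) :=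
    l₂.norm1_restrict hn₂ (measurableSet_elim_absMarginal_le hn₂ μ₂)
  -- both triples are compared off the common set `E`; what is left over besides `{d₂ ≤ 1}` is `F`,
  -- where the marginal of the second triple is close in mean to that of the first, which is at most `1`
  set E := {z | 1 < d₁ z ∧ 1 < d₂ z} with hEdef
  set F := {z | 1 < d₂ z ∧ d₁ z ≤ 1} with hFdef
  have hE : MeasurableSet E :=
    (measurableSet_lt measurable_const m₁).inter (measurableSet_lt measurable_const m₂)
  have hF : MeasurableSet F :=
    (measurableSet_lt measurable_const m₂).inter (measurableSet_le m₁ measurable_const)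
  have hν : ν {z | 1 < d₂ z} ≤ C := by
    rw [hd₂, l₂.measure_lt_liftMarginal hn₂]
    exact (l₂.near.le _).trans hC
  have hEC : ν E ≤ C := (measure_mono fun z hz => hz.2).trans hν
  have hFC : ν F ≤ C := (measure_mono fun z hz => hz.1).trans hν
  have hsub : Eᶜ = {z | d₂ z ≤ 1} ∪ F := by
    ext z
    simp only [hEdef, hFdef, mem_compl_iff, mem_ofPred_eq, mem_union]
    rcases le_or_gt (d₂ z) 1 with h | h <;> rcases le_or_gt (d₁ z) 1 with h' | h' <;>
      simp [h, h', not_lt.2, not_le.2]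
  have hAE : {z | d₁ z ≤ 1} ⊆ Eᶜ := fun z hz hz' => not_lt.2 hz hz'.1
  have hdisj : Disjoint {z | d₂ z ≤ 1} F :=
    Set.disjoint_left.2 fun z hz hz' => not_lt.2 hz hz'.1
  have hFint : ∫⁻ z in F, (𝕎₂.extend.pullback π₂).absMarginal ν z ∂ν ≤
      ν F + ε ^ 2 * C ^ (1 / 2 : ℝ) := by
    refine (h₂₁.D_le F hF).trans ?_
    gcongr
    calc _ ≤ ∫⁻ _ in F, 1 ∂ν := setLIntegral_mono' hF fun z hz =>
            (l₁.le_liftMarginal hn₁ z).trans hz.2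
      _ = ν F := by simp
  calc 𝕎₁.norm1 (μ₁.restrict {x | 𝕎₁.absMarginal μ₁ x ≤ 1})
      ≤ (𝕎₁.extend.pullback π₁).norm1 (ν.restrict {z | d₁ z ≤ 1}) + 4 * ε ^ 2 := by
        rw [r₁]; exact norm1_restrict_le_of_near hn₁ l₁.near
    _ ≤ (𝕎₁.extend.pullback π₁).norm1 (ν.restrict Eᶜ) + 4 * ε ^ 2 := by
        gcongr
        refine Triple.norm1_mono _ (Measure.restrict_mono hAE le_rfl)
    _ ≤ (𝕎₂.extend.pullback π₂).norm1 (ν.restrict Eᶜ) +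
        (ε ^ 3 + ε * ν E + 2 * (ε ^ 2 * ν E ^ (1 / 2 : ℝ))) + 4 * ε ^ 2 := by
        gcongr
        exact h₁₂.norm1_compl_le h₂₁ p₁ p₂ ((l₁.norm1_eq hn₁).trans_lt l₁.norm1_lt_top) hE
          (hEC.trans_lt hCf)
    _ ≤ ((𝕎₂.extend.pullback π₂).norm1 (ν.restrict {z | d₂ z ≤ 1}) +
        2 * ∫⁻ z in F, (𝕎₂.extend.pullback π₂).absMarginal ν z ∂ν) +
        (ε ^ 3 + ε * ν E + 2 * (ε ^ 2 * ν E ^ (1 / 2 : ℝ))) + 4 * ε ^ 2 := by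
        gcongr
        rw [hsub]
        exact p₂.norm1_restrict_union_le ν hF hdisj
    _ ≤ (𝕎₂.norm1 (μ₂.restrict {x | 𝕎₂.absMarginal μ₂ x ≤ 1}) +
        2 * (ν F + ε ^ 2 * C ^ (1 / 2 : ℝ))) +
        (ε ^ 3 + ε * C + 2 * (ε ^ 2 * C ^ (1 / 2 : ℝ))) + 4 * ε ^ 2 := by
        rw [r₂]
        gcongr
        exact Triple.norm1_mono _ (Measure.restrict_mono le_rfl l₂.near.le)
    _ = _ := by ring

/-! ### The limit coupling -/

/-- The points whose marginal exceeds `1 / (m + 1)`. -/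
def marginalSet {Ω : Type*} [MeasurableSpace Ω] (𝕎 : Triple Ω) (μ : Measure Ω) (m : ℕ) : Set Ω :=
  {x | ((m : ℝ≥0∞) + 1)⁻¹ < 𝕎.absMarginal μ x}

section

variable {Ω : Type*} [MeasurableSpace Ω] {𝕎 : Triple Ω} {μ : Measure Ω}

theorem marginalSet_mono : Monotone (marginalSet 𝕎 μ) := fun m k hmk x hx =>
  lt_of_le_of_lt (ENNReal.inv_le_inv.2 (by gcongr)) hx

theorem measurableSet_marginalSet (hn : 𝕎.IsNonneg) [SFinite μ] (m : ℕ) :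
    MeasurableSet (marginalSet 𝕎 μ m) :=
  measurableSet_lt measurable_const (hn.measurable_absMarginal μ)

theorem exists_inv_nat_add_one_lt {b : ℝ≥0∞} (hb : 0 < b) : ∃ m : ℕ, ((m : ℝ≥0∞) + 1)⁻¹ < b := by
  obtain ⟨m, hm⟩ := ENNReal.exists_inv_nat_lt hb.ne'
  exact ⟨m, lt_of_le_of_lt (ENNReal.inv_le_inv.2 le_self_add) hm⟩

theorem iUnion_marginalSet (hD : ∀ x, 0 < 𝕎.absMarginal μ x) : ⋃ m, marginalSet 𝕎 μ m = univ :=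
  eq_univ_of_forall fun x => mem_iUnion.2 (exists_inv_nat_add_one_lt (hD x))

theorem marginalSet_zero : marginalSet 𝕎 μ 0 = {x | 1 < 𝕎.absMarginal μ x} := by
  simp [marginalSet]

end

/-- A single lift of small defect already shows that marginals bounded away from zero occur only on
a set of finite measure. -/
theorem IsGraphex.measure_lt_absMarginal_lt_top {Ω Z : Type*} [MeasurableSpace Ω]
    [MeasurableSpace Z] {𝕎 : Triple Ω} {μ : Measure Ω} (h : IsGraphex 𝕎 μ)
    {μ' : ℕ → Measure Ω} {ν : ℕ → Measure Z} {π : Z → Ω ⊕ ℝ} {ε : ℕ → ℝ≥0∞} {l : Filter ℕ}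
    [l.NeBot] (hl : ∀ n, IsLift 𝕎 μ (μ' n) (ν n) π (ε n)) (hε : Tendsto ε l (𝓝 0)) {b : ℝ≥0∞}
    (hb : 0 < b) : μ {x | b < 𝕎.absMarginal μ x} < ∞ := by
  have := h.sigmaFinite
  have h0 : Tendsto (fun n => ε n ^ 2) l (𝓝 0) := by simpa using ENNReal.Tendsto.pow hε (n := 2)
  obtain ⟨n, hn⟩ := (h0.eventually (gt_mem_nhds hb)).exists
  have : SigmaFinite (μ' n) := Measure.sigmaFinite_of_le μ (hl n).near.le
  exact Graphex.measure_lt_absMarginal_lt_top h.isNonneg (fun x y => (h.W_mem x y).2) (hl n).near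
    (hl n).norm1_lt_top hn

/-- The set of points of `Z` over the rectangle with sides `A` and `B`. -/
def liftRect {Ω₁ Ω₂ Z : Type*} (π₁ : Z → Ω₁ ⊕ ℝ) (π₂ : Z → Ω₂ ⊕ ℝ) (A : Set Ω₁) (B : Set Ω₂) :
    Set Z :=
  π₁ ⁻¹' (Sum.inl '' A) ∩ π₂ ⁻¹' (Sum.inl '' B)

/-- `κ` is the limit along `l` of the parts over `Ω₁ × Ω₂` of measures `ν n` that lift submeasures of
`μ₁` and `μ₂` and over which the two triples get closer and closer. Convergence is required on
rectangles of points with marginals bounded away from zero. -/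
structure IsCouplingLimit {Ω₁ Ω₂ Z : Type*} [MeasurableSpace Ω₁] [MeasurableSpace Ω₂]
    [MeasurableSpace Z] (𝕎₁ : Triple Ω₁) (μ₁ : Measure Ω₁) (𝕎₂ : Triple Ω₂) (μ₂ : Measure Ω₂)
    (μ₁' : ℕ → Measure Ω₁) (μ₂' : ℕ → Measure Ω₂) (ν : ℕ → Measure Z) (π₁ : Z → Ω₁ ⊕ ℝ)
    (π₂ : Z → Ω₂ ⊕ ℝ) (ε : ℕ → ℝ≥0∞) (l : Filter ℕ) (κ : Measure (Ω₁ × Ω₂)) : Prop where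
  graphex₁ : IsGraphex 𝕎₁ μ₁
  graphex₂ : IsGraphex 𝕎₂ μ₂
  marginal_pos₁ : ∀ x, 0 < 𝕎₁.absMarginal μ₁ x
  marginal_pos₂ : ∀ x, 0 < 𝕎₂.absMarginal μ₂ x
  neBot : l.NeBot
  tendsto_zero : Tendsto ε l (𝓝 0)
  sigmaFinite : ∀ n, SigmaFinite (ν n)
  lift₁ : ∀ n, IsLift 𝕎₁ μ₁ (μ₁' n) (ν n) π₁ (ε n)
  lift₂ : ∀ n, IsLift 𝕎₂ μ₂ (μ₂' n) (ν n) π₂ (ε n)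
  close₁₂ : ∀ n, IsClose (𝕎₁.extend.pullback π₁) (𝕎₂.extend.pullback π₂) (ν n) (ε n)
  close₂₁ : ∀ n, IsClose (𝕎₂.extend.pullback π₂) (𝕎₁.extend.pullback π₁) (ν n) (ε n)
  tendsto_rect : ∀ m A B, MeasurableSet A → MeasurableSet B → A ⊆ marginalSet 𝕎₁ μ₁ m →
    B ⊆ marginalSet 𝕎₂ μ₂ m →
    Tendsto (fun n => ν n (liftRect π₁ π₂ A B)) l (𝓝 (κ (A ×ˢ B)))

namespace IsCouplingLimit

variable {Ω₁ Ω₂ Z : Type*} [MeasurableSpace Ω₁] [MeasurableSpace Ω₂]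
    [MeasurableSpace Z] {𝕎₁ : Triple Ω₁} {μ₁ : Measure Ω₁} {𝕎₂ : Triple Ω₂} {μ₂ : Measure Ω₂}
    {μ₁' : ℕ → Measure Ω₁} {μ₂' : ℕ → Measure Ω₂} {ν : ℕ → Measure Z} {π₁ : Z → Ω₁ ⊕ ℝ}
    {π₂ : Z → Ω₂ ⊕ ℝ} {ε : ℕ → ℝ≥0∞} {l : Filter ℕ} {κ : Measure (Ω₁ × Ω₂)}

theorem swap (h : IsCouplingLimit 𝕎₁ μ₁ 𝕎₂ μ₂ μ₁' μ₂' ν π₁ π₂ ε l κ) :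
    IsCouplingLimit 𝕎₂ μ₂ 𝕎₁ μ₁ μ₂' μ₁' ν π₂ π₁ ε l (κ.map Prod.swap) where
  graphex₁ := h.graphex₂
  graphex₂ := h.graphex₁
  marginal_pos₁ := h.marginal_pos₂
  marginal_pos₂ := h.marginal_pos₁
  neBot := h.neBot
  tendsto_zero := h.tendsto_zero
  sigmaFinite := h.sigmaFinite
  lift₁ := h.lift₂
  lift₂ := h.lift₁
  close₁₂ := h.close₂₁
  close₂₁ := h.close₁₂
  tendsto_rect m A B hA hB hAm hBm := by
    rw [Measure.map_apply measurable_swap (hA.prod hB), preimage_swap_prod]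
    simpa only [liftRect, inter_comm] using h.tendsto_rect m B A hB hA hBm hAm

variable (h : IsCouplingLimit 𝕎₁ μ₁ 𝕎₂ μ₂ μ₁' μ₂' ν π₁ π₂ ε l κ)
include h

theorem measure_lt_absMarginal_lt_top {b : ℝ≥0∞} (hb : 0 < b) :
    μ₁ {x | b < 𝕎₁.absMarginal μ₁ x} < ∞ := by
  have := h.neBot
  exact h.graphex₁.measure_lt_absMarginal_lt_top h.lift₁ h.tendsto_zero hb

theorem measure_marginalSet_lt_top (m : ℕ) : μ₁ (marginalSet 𝕎₁ μ₁ m) < ∞ :=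
  h.measure_lt_absMarginal_lt_top (by simp)

/-- In the limit, no mass couples a marginal greater than `b` to one that is at most `a < b`. -/
theorem tendsto_measure_gap {a b : ℝ≥0∞} (hab : a < b) :
    Tendsto (fun n => ν n {z | b < liftMarginal 𝕎₁ μ₁ π₁ z ∧ liftMarginal 𝕎₂ μ₂ π₂ z ≤ a}) l
      (𝓝 0) := by
  have hs₁ := h.graphex₁.sigmaFinite
  have hs₂ := h.graphex₂.sigmaFinite
  rcases eq_or_ne b ∞ with rfl | hb
  · simpa using tendsto_const_nhds
  set C := μ₁ {x | b < 𝕎₁.absMarginal μ₁ x} with hC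
  have hCf : C < ∞ := h.measure_lt_absMarginal_lt_top (bot_lt_of_lt hab)
  have hlim : Tendsto (fun n => ε n ^ 2 * (C ^ (1 / 2 : ℝ) + C) / (b - a)) l (𝓝 0) := by
    have h0 : Tendsto (fun n => ε n ^ 2) l (𝓝 0) := by
      simpa using ENNReal.Tendsto.pow h.tendsto_zero (n := 2)
    have hC' : C ^ (1 / 2 : ℝ) + C ≠ ∞ := ENNReal.add_ne_top.2
      ⟨ENNReal.rpow_ne_top_of_nonneg (by norm_num) hCf.ne, hCf.ne⟩
    have h1 := ENNReal.Tendsto.mul_const (b := C ^ (1 / 2 : ℝ) + C) h0 (Or.inr hC')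
    have h2 := ENNReal.Tendsto.div_const (b := b - a) h1 (Or.inr (tsub_pos_of_lt hab).ne')
    simpa using h2
  refine tendsto_of_tendsto_of_tendsto_of_le_of_le tendsto_const_nhds hlim
    (fun n => zero_le) fun n => ?_
  have := h.sigmaFinite n
  have key := (h.close₁₂ n).mul_measure_le
    (measurable_liftMarginal h.graphex₁.isNonneg μ₁ (h.lift₁ n).measurable)
    (measurable_liftMarginal h.graphex₂.isNonneg μ₂ (h.lift₂ n).measurable)
    ((h.lift₁ n).liftMarginal_le h.graphex₁.isNonneg fun x y => (h.graphex₁.W_mem x y).2)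
    ((h.lift₂ n).le_liftMarginal h.graphex₂.isNonneg) a b
  set x := ν n {z | b < liftMarginal 𝕎₁ μ₁ π₁ z ∧ liftMarginal 𝕎₂ μ₂ π₂ z ≤ a}
  have hx : x ≤ C := by
    refine (measure_mono (t := {z | b < liftMarginal 𝕎₁ μ₁ π₁ z}) fun z hz => hz.1).trans ?_
    rw [(h.lift₁ n).measure_lt_liftMarginal h.graphex₁.isNonneg]
    exact (h.lift₁ n).near.le _
  have hxf : x ≠ ∞ := (hx.trans_lt hCf).ne
  show x ≤ _
  rw [ENNReal.le_div_iff_mul_le (Or.inl (tsub_pos_of_lt hab).ne')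
    (Or.inl (ENNReal.sub_ne_top hb)), mul_comm, ENNReal.sub_mul fun _ _ => hxf]
  refine tsub_le_iff_left.2 (key.trans ?_)
  gcongr

/-- No mass escapes: points of marginal greater than `1 / (m + 1)` are coupled in the limit to points
of marginal greater than `1 / (k + 1)` only, for any `k > m`. In particular they are coupled neither
to the appended real line nor to sets running off to infinity. -/
theorem measure_prod_marginalSet {m k : ℕ} (hmk : m < k) {A : Set Ω₁} (hA : MeasurableSet A)
    (hAm : A ⊆ marginalSet 𝕎₁ μ₁ m) : κ (A ×ˢ marginalSet 𝕎₂ μ₂ k) = μ₁ A := by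
  have := h.neBot
  have hs₂ := h.graphex₂.sigmaFinite
  have hT := measurableSet_marginalSet (μ := μ₂) h.graphex₂.isNonneg k
  have hlim := h.tendsto_rect k A _ hA hT (hAm.trans (marginalSet_mono hmk.le)) le_rfl
  refine le_antisymm (le_of_tendsto' hlim fun n => ?_) ?_
  · refine (measure_mono inter_subset_left).trans ?_
    rw [(h.lift₁ n).measure_preimage hA]
    exact (h.lift₁ n).near.le _
  · have hab : ((k : ℝ≥0∞) + 1)⁻¹ < ((m : ℝ≥0∞) + 1)⁻¹ :=
      ENNReal.inv_lt_inv.2 (by exact_mod_cast Nat.succ_lt_succ hmk)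
    have h0 : Tendsto (fun n => ε n ^ 2) l (𝓝 0) := by
      simpa using ENNReal.Tendsto.pow h.tendsto_zero (n := 2)
    have hlim' := (hlim.add (h.tendsto_measure_gap hab)).add h0
    rw [add_zero, add_zero] at hlim'
    refine ge_of_tendsto' hlim' fun n => ((h.lift₁ n).near A hA).1.trans ?_
    gcongr
    rw [← (h.lift₁ n).measure_preimage hA]
    refine (measure_mono fun z hz => ?_).trans (measure_union_le _ _)
    by_cases hz2 : π₂ z ∈ Sum.inl '' marginalSet 𝕎₂ μ₂ k
    · exact Or.inl ⟨hz, hz2⟩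
    · refine Or.inr ⟨?_, ?_⟩
      · obtain ⟨x, hx, hxz⟩ := hz
        rw [liftMarginal, ← hxz]
        exact hAm hx
      · rw [liftMarginal]
        rcases hπ : π₂ z with y | t
        · rw [hπ] at hz2
          exact not_lt.1 fun hy => hz2 ⟨y, hy, rfl⟩
        · simp

/-- The limit is a coupling, because the marginal is positive everywhere. -/
theorem map_fst : κ.map Prod.fst = μ₁ := by
  have hs₁ := h.graphex₁.sigmaFinite
  have hs₂ := h.graphex₂.sigmaFinite
  have hsub : ∀ m A, MeasurableSet A → A ⊆ marginalSet 𝕎₁ μ₁ m → κ (Prod.fst ⁻¹' A) = μ₁ A := by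
    intro m A hA hAm
    have hU : Prod.fst ⁻¹' A = ⋃ k, A ×ˢ marginalSet 𝕎₂ μ₂ k := by
      rw [← prod_iUnion, iUnion_marginalSet h.marginal_pos₂, prod_univ]
    have hmono : Monotone fun k => A ×ˢ marginalSet 𝕎₂ μ₂ k := fun k k' hk =>
      prod_mono_right (marginalSet_mono hk)
    rw [hU]
    refine tendsto_nhds_unique (tendsto_measure_iUnion_atTop hmono) ?_
    refine tendsto_const_nhds.congr' ?_
    filter_upwards [eventually_gt_atTop m] with k hk
    exact (h.measure_prod_marginalSet hk hA hAm).symm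
  ext A hA
  rw [Measure.map_apply measurable_fst hA]
  have hU : A = ⋃ m, A ∩ marginalSet 𝕎₁ μ₁ m := by
    rw [← inter_iUnion, iUnion_marginalSet h.marginal_pos₁, inter_univ]
  have hmono : Monotone fun m => A ∩ marginalSet 𝕎₁ μ₁ m := fun k k' hk =>
    inter_subset_inter_right _ (marginalSet_mono hk)
  rw [hU, preimage_iUnion]
  refine tendsto_nhds_unique (tendsto_measure_iUnion_atTop fun k k' hk => preimage_mono (hmono hk))
    ((tendsto_measure_iUnion_atTop hmono).congr fun m => ?_)
  exact (hsub m _ (hA.inter (measurableSet_marginalSet h.graphex₁.isNonneg m))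
    inter_subset_right).symm

theorem map_snd : κ.map Prod.snd = μ₂ := by
  have := h.swap.map_fst
  rwa [Measure.map_map measurable_fst measurable_swap] at this

theorem sigmaFinite_limit : SigmaFinite κ := by
  refine SigmaFinite.of_map κ measurable_fst.aemeasurable ?_
  rw [h.map_fst]
  exact h.graphex₁.sigmaFinite

theorem measure_prod_gap {a b : ℝ≥0∞} (hab : a < b) :
    κ ({x | b < 𝕎₁.absMarginal μ₁ x} ×ˢ {y | 𝕎₂.absMarginal μ₂ y ≤ a}) = 0 := by
  have := h.neBot
  have hs₁ := h.graphex₁.sigmaFinite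
  have hs₂ := h.graphex₂.sigmaFinite
  have hA : MeasurableSet {x | b < 𝕎₁.absMarginal μ₁ x} :=
    measurableSet_lt measurable_const (h.graphex₁.isNonneg.measurable_absMarginal μ₁)
  have hB : MeasurableSet {y | 𝕎₂.absMarginal μ₂ y ≤ a} :=
    measurableSet_le (h.graphex₂.isNonneg.measurable_absMarginal μ₂) measurable_const
  have hU : {y | 𝕎₂.absMarginal μ₂ y ≤ a} =
      ⋃ k, {y | 𝕎₂.absMarginal μ₂ y ≤ a} ∩ marginalSet 𝕎₂ μ₂ k := by
    rw [← inter_iUnion, iUnion_marginalSet h.marginal_pos₂, inter_univ]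
  obtain ⟨m, hm⟩ := exists_inv_nat_add_one_lt (bot_lt_of_lt hab)
  rw [hU, prod_iUnion, measure_iUnion_null_iff]
  intro k
  have hlim := h.tendsto_rect (max m k) _ _ hA
    (hB.inter (measurableSet_marginalSet h.graphex₂.isNonneg k))
    (fun x hx => marginalSet_mono (le_max_left m k) (hm.trans hx))
    (inter_subset_right.trans (marginalSet_mono (le_max_right m k)))
  refine le_antisymm (le_of_tendsto_of_tendsto' hlim (h.tendsto_measure_gap hab) fun n =>
    measure_mono ?_) zero_le
  rintro z ⟨⟨x, hx, hxz⟩, ⟨y, hy, hyz⟩⟩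
  rw [mem_ofPred_eq, liftMarginal, liftMarginal, ← hxz, ← hyz]
  exact ⟨hx, hy.1⟩

theorem ae_absMarginal_le : ∀ᵐ p ∂κ, 𝕎₁.absMarginal μ₁ p.1 ≤ 𝕎₂.absMarginal μ₂ p.2 := by
  have hq : ∀ q r : ℚ, ∀ᵐ p ∂κ, (Real.toNNReal q : ℝ≥0∞) < Real.toNNReal r →
      ¬ ((Real.toNNReal r : ℝ≥0∞) < 𝕎₁.absMarginal μ₁ p.1 ∧
        𝕎₂.absMarginal μ₂ p.2 ≤ Real.toNNReal q) := by
    intro q r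
    by_cases hqr : (Real.toNNReal q : ℝ≥0∞) < Real.toNNReal r
    · have := measure_eq_zero_iff_ae_notMem.1 (h.measure_prod_gap hqr)
      filter_upwards [this] with p hp _ using hp
    · exact ae_of_all _ fun p hp => absurd hp hqr
  filter_upwards [ae_all_iff.2 fun q => ae_all_iff.2 (hq q)] with p hp
  by_contra! hlt
  obtain ⟨r, -, hr1, hr2⟩ := ENNReal.lt_iff_exists_rat_btwn.1 hlt
  obtain ⟨q, -, hq1, hq2⟩ := ENNReal.lt_iff_exists_rat_btwn.1 hr1
  exact hp q r hq2 ⟨hr2, hq1.le⟩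

theorem ae_absMarginal_eq : ∀ᵐ p ∂κ, 𝕎₁.absMarginal μ₁ p.1 = 𝕎₂.absMarginal μ₂ p.2 := by
  have := ae_of_ae_map measurable_swap.aemeasurable h.swap.ae_absMarginal_le
  filter_upwards [h.ae_absMarginal_le, this] with p h1 h2 using le_antisymm h1 h2

end IsCouplingLimit

/-! ### The kernels and star parts agree -/

theorem Triple.IsNonneg.lintegral_W_extend_pullback {Ω Z : Type*} [MeasurableSpace Ω]
    [MeasurableSpace Z] {𝕎 : Triple Ω} (hn : 𝕎.IsNonneg) {π : Z → Ω ⊕ ℝ} (hπ : Measurable π)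
    (a b : Measure Z) [SFinite a] [SFinite b] [SFinite ((a.map π).comap Sum.inl)]
    [SFinite ((b.map π).comap Sum.inl)] :
    ∫⁻ p, ‖(𝕎.extend.pullback π).W p.1 p.2‖ₑ ∂(a.prod b) =
      ∫⁻ p, ‖𝕎.W p.1 p.2‖ₑ ∂(((a.map π).comap Sum.inl).prod ((b.map π).comap Sum.inl)) := by
  have e1 : ∫⁻ p, ‖(𝕎.extend.pullback π).W p.1 p.2‖ₑ ∂(a.prod b) =
      ∫⁻ p, ‖𝕎.extend.W p.1 p.2‖ₑ ∂((a.map π).prod (b.map π)) := by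
    rw [Measure.map_prod_map _ _ hπ hπ, lintegral_map hn.extend.measurable_enorm_W (by fun_prop)]
    rfl
  rw [e1, lintegral_prod _ hn.extend.measurable_enorm_W.aemeasurable,
    lintegral_prod _ hn.measurable_enorm_W.aemeasurable, lintegral_sum_eq_comap_inl]
  · refine lintegral_congr fun x => ?_
    rw [lintegral_sum_eq_comap_inl _ _ (by simp [Triple.extend])]
    simp [Triple.extend]
  · simp [Triple.extend]

namespace IsCouplingLimit

variable {Ω₁ Ω₂ Z : Type*} [MeasurableSpace Ω₁] [MeasurableSpace Ω₂]
    [MeasurableSpace Z] {𝕎₁ : Triple Ω₁} {μ₁ : Measure Ω₁} {𝕎₂ : Triple Ω₂} {μ₂ : Measure Ω₂}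
    {μ₁' : ℕ → Measure Ω₁} {μ₂' : ℕ → Measure Ω₂} {ν : ℕ → Measure Z} {π₁ : Z → Ω₁ ⊕ ℝ}
    {π₂ : Z → Ω₂ ⊕ ℝ} {ε : ℕ → ℝ≥0∞} {l : Filter ℕ} {κ : Measure (Ω₁ × Ω₂)}

variable (h : IsCouplingLimit 𝕎₁ μ₁ 𝕎₂ μ₂ μ₁' μ₂' ν π₁ π₂ ε l κ)
include h

theorem measurableSet_liftRect {A : Set Ω₁} {B : Set Ω₂} (hA : MeasurableSet A)
    (hB : MeasurableSet B) : MeasurableSet (liftRect π₁ π₂ A B) :=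
  ((h.lift₁ 0).measurable hA.inl_image).inter ((h.lift₂ 0).measurable hB.inl_image)

/-- The mass that the part of `ν n` over `A × B` gives to `C`. -/
theorem comap_restrict_liftRect (n : ℕ) {A : Set Ω₁} {B : Set Ω₂} (C : Set Ω₁)
    (hC : MeasurableSet C) :
    (((ν n).restrict (liftRect π₁ π₂ A B)).map π₁).comap Sum.inl C =
      ν n (liftRect π₁ π₂ (A ∩ C) B) := by
  have hπ := (h.lift₁ n).measurable
  rw [measurableEmbedding_inl.comap_apply, Measure.map_apply hπ hC.inl_image,
    Measure.restrict_apply (hπ hC.inl_image)]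
  congr 1
  rw [liftRect, liftRect, ← inter_assoc, ← preimage_inter, ← image_inter Sum.inl_injective,
    inter_comm C A]

/-- The projections to `Ω₁` of the parts of `ν n` over rectangles are dominated by finite restrictions
of `μ₁` and converge setwise, hence so do their products, against which `W` is integrated. -/
theorem tendsto_lintegral_W (m : ℕ) {A A' : Set Ω₁} {B B' : Set Ω₂} (hA : MeasurableSet A)
    (hA' : MeasurableSet A') (hB : MeasurableSet B) (hB' : MeasurableSet B')
    (hAm : A ⊆ marginalSet 𝕎₁ μ₁ m) (hA'm : A' ⊆ marginalSet 𝕎₁ μ₁ m)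
    (hBm : B ⊆ marginalSet 𝕎₂ μ₂ m) (hB'm : B' ⊆ marginalSet 𝕎₂ μ₂ m) :
    Tendsto (fun n => ∫⁻ p, ‖(𝕎₁.extend.pullback π₁).W p.1 p.2‖ₑ
        ∂(((ν n).restrict (liftRect π₁ π₂ A B)).prod ((ν n).restrict (liftRect π₁ π₂ A' B')))) l
      (𝓝 (∫⁻ p, ‖𝕎₁.W p.1 p.2‖ₑ ∂(((κ.restrict (A ×ˢ B)).map Prod.fst).prod
        ((κ.restrict (A' ×ˢ B')).map Prod.fst)))) := by
  have := h.neBot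
  have hs₁ := h.graphex₁.sigmaFinite
  have hsn := h.sigmaFinite
  have hn := h.graphex₁.isNonneg
  have hfin : ∀ {A : Set Ω₁}, A ⊆ marginalSet 𝕎₁ μ₁ m → IsFiniteMeasure (μ₁.restrict A) :=
    fun hAm => ⟨by
      rw [Measure.restrict_apply_univ]
      exact (measure_mono hAm).trans_lt (h.measure_marginalSet_lt_top m)⟩
  have hle : ∀ (n : ℕ) {A : Set Ω₁} {B : Set Ω₂}, MeasurableSet A →
      (((ν n).restrict (liftRect π₁ π₂ A B)).map π₁).comap Sum.inl ≤ μ₁.restrict A := by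
    intro n A B hA
    refine Measure.le_iff.2 fun C hC => ?_
    rw [h.comap_restrict_liftRect n C hC, Measure.restrict_apply hC, inter_comm]
    refine (measure_mono inter_subset_left).trans ?_
    rw [(h.lift₁ n).measure_preimage (hC.inter hA)]
    exact (h.lift₁ n).near.le _
  have hlim : ∀ {A : Set Ω₁} {B : Set Ω₂}, MeasurableSet A → MeasurableSet B →
      A ⊆ marginalSet 𝕎₁ μ₁ m → B ⊆ marginalSet 𝕎₂ μ₂ m → ∀ C, MeasurableSet C →
      Tendsto (fun n => (((ν n).restrict (liftRect π₁ π₂ A B)).map π₁).comap Sum.inl C) l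
        (𝓝 ((κ.restrict (A ×ˢ B)).map Prod.fst C)) := by
    intro A B hA hB hAm hBm C hC
    simp_rw [fun n => h.comap_restrict_liftRect n (A := A) (B := B) C hC]
    rw [Measure.map_apply measurable_fst hC, Measure.restrict_apply (measurable_fst hC)]
    have e : Prod.fst ⁻¹' C ∩ A ×ˢ B = (A ∩ C) ×ˢ B := by
      ext p; simp only [mem_inter_iff, mem_preimage, mem_prod]; tauto
    rw [e]
    exact h.tendsto_rect m _ _ (hA.inter hC) hB (inter_subset_left.trans hAm) hBm
  have f1 := hfin hAm
  have f2 := hfin hA'm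
  have f3 : ∀ n, IsFiniteMeasure
      ((((ν n).restrict (liftRect π₁ π₂ A B)).map π₁).comap Sum.inl) :=
    fun n => isFiniteMeasure_of_le _ (hle n hA)
  have f4 : ∀ n, IsFiniteMeasure
      ((((ν n).restrict (liftRect π₁ π₂ A' B')).map π₁).comap Sum.inl) :=
    fun n => isFiniteMeasure_of_le _ (hle n hA')
  simp_rw [fun n => hn.lintegral_W_extend_pullback (h.lift₁ n).measurable
    ((ν n).restrict (liftRect π₁ π₂ A B)) ((ν n).restrict (liftRect π₁ π₂ A' B'))]
  refine tendsto_lintegral_of_setwise (M := (μ₁.restrict A).prod (μ₁.restrict A'))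
    (fun n => Measure.prod_mono (hle n hA) (hle n hA'))
    (fun C hC => tendsto_prod_of_setwise (fun n => hle n hA) (fun n => hle n hA')
      (hlim hA hB hAm hBm) (hlim hA' hB' hA'm hB'm) hC) hn.measurable_enorm_W ?_
  refine (lt_of_le_of_lt (lintegral_mono (g := fun _ => 1) fun p => ?_) ?_).ne
  · rw [Real.enorm_of_nonneg (hn.W_nonneg _ _)]
    simpa using (h.graphex₁.W_mem p.1 p.2).2
  · simp

theorem tendsto_lintegral_W_right (m : ℕ) {A A' : Set Ω₁} {B B' : Set Ω₂} (hA : MeasurableSet A)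
    (hA' : MeasurableSet A') (hB : MeasurableSet B) (hB' : MeasurableSet B')
    (hAm : A ⊆ marginalSet 𝕎₁ μ₁ m) (hA'm : A' ⊆ marginalSet 𝕎₁ μ₁ m)
    (hBm : B ⊆ marginalSet 𝕎₂ μ₂ m) (hB'm : B' ⊆ marginalSet 𝕎₂ μ₂ m) :
    Tendsto (fun n => ∫⁻ p, ‖(𝕎₂.extend.pullback π₂).W p.1 p.2‖ₑ
        ∂(((ν n).restrict (liftRect π₁ π₂ A B)).prod ((ν n).restrict (liftRect π₁ π₂ A' B')))) l
      (𝓝 (∫⁻ p, ‖𝕎₂.W p.1 p.2‖ₑ ∂(((κ.restrict (A ×ˢ B)).map Prod.snd).prod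
        ((κ.restrict (A' ×ˢ B')).map Prod.snd)))) := by
  have key := h.swap.tendsto_lintegral_W m hB hB' hA hA' hBm hB'm hAm hA'm
  have e : ∀ {A : Set Ω₁} {B : Set Ω₂}, MeasurableSet A → MeasurableSet B →
      ((κ.map Prod.swap).restrict (B ×ˢ A)).map Prod.fst =
        (κ.restrict (A ×ˢ B)).map Prod.snd := by
    intro A B hA hB
    rw [Measure.restrict_map measurable_swap (hB.prod hA), preimage_swap_prod,
      Measure.map_map measurable_fst measurable_swap]
    rfl
  rw [e hA hB, e hA' hB'] at key
  simpa only [liftRect, inter_comm] using key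

theorem lintegral_W_rect_eq (m : ℕ) {A A' : Set Ω₁} {B B' : Set Ω₂} (hA : MeasurableSet A)
    (hA' : MeasurableSet A') (hB : MeasurableSet B) (hB' : MeasurableSet B')
    (hAm : A ⊆ marginalSet 𝕎₁ μ₁ m) (hA'm : A' ⊆ marginalSet 𝕎₁ μ₁ m)
    (hBm : B ⊆ marginalSet 𝕎₂ μ₂ m) (hB'm : B' ⊆ marginalSet 𝕎₂ μ₂ m) :
    ∫⁻ p, ‖𝕎₁.W p.1.1 p.2.1‖ₑ ∂((κ.restrict (A ×ˢ B)).prod (κ.restrict (A' ×ˢ B'))) =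
      ∫⁻ p, ‖𝕎₂.W p.1.2 p.2.2‖ₑ ∂((κ.restrict (A ×ˢ B)).prod (κ.restrict (A' ×ˢ B'))) := by
  have := h.neBot
  have hs₁ := h.graphex₁.sigmaFinite
  have hsκ := h.sigmaFinite_limit
  have hE := h.measurableSet_liftRect hA hB
  have hE' := h.measurableSet_liftRect hA' hB'
  have l₁ := h.tendsto_lintegral_W m hA hA' hB hB' hAm hA'm hBm hB'm
  have l₂ := h.tendsto_lintegral_W_right m hA hA' hB hB' hAm hA'm hBm hB'm
  set C := μ₁ (marginalSet 𝕎₁ μ₁ m) with hC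
  have hCf : C ^ (1 / 2 : ℝ) * C ^ (1 / 2 : ℝ) ≠ ∞ := by
    have := ENNReal.rpow_ne_top_of_nonneg (y := 1 / 2) (by norm_num)
      (h.measure_marginalSet_lt_top m).ne
    exact ENNReal.mul_ne_top this this
  have hνC : ∀ n {A : Set Ω₁} {B : Set Ω₂}, MeasurableSet A → A ⊆ marginalSet 𝕎₁ μ₁ m →
      ν n (liftRect π₁ π₂ A B) ≤ C := by
    intro n A B hA hAm
    refine (measure_mono inter_subset_left).trans ?_
    rw [(h.lift₁ n).measure_preimage hA]
    exact ((h.lift₁ n).near.le _).trans (measure_mono hAm)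
  have herr : Tendsto (fun n => ε n * (C ^ (1 / 2 : ℝ) * C ^ (1 / 2 : ℝ))) l (𝓝 0) := by
    simpa using ENNReal.Tendsto.mul_const h.tendsto_zero (Or.inr hCf)
  have hbound : ∀ {𝕍 𝕍' : Triple Z} n, IsClose 𝕍 𝕍' (ν n) (ε n) →
      ∫⁻ p, ‖𝕍.W p.1 p.2‖ₑ ∂(((ν n).restrict (liftRect π₁ π₂ A B)).prod
        ((ν n).restrict (liftRect π₁ π₂ A' B'))) ≤
      ∫⁻ p, ‖𝕍'.W p.1 p.2‖ₑ ∂(((ν n).restrict (liftRect π₁ π₂ A B)).prod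
        ((ν n).restrict (liftRect π₁ π₂ A' B'))) +
        ε n * (C ^ (1 / 2 : ℝ) * C ^ (1 / 2 : ℝ)) := by
    intro 𝕍 𝕍' n hc
    have b1 := hνC n (B := B) hA hAm
    have b2 := hνC n (B := B') hA' hA'm
    refine (hc.W_le _ _ hE hE' (b1.trans_lt (h.measure_marginalSet_lt_top m))
      (b2.trans_lt (h.measure_marginalSet_lt_top m))).trans ?_
    gcongr
  have e₁ := le_of_tendsto_of_tendsto' l₁ (l₂.add herr) fun n => hbound n (h.close₁₂ n)
  have e₂ := le_of_tendsto_of_tendsto' l₂ (l₁.add herr) fun n => hbound n (h.close₂₁ n)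
  rw [add_zero] at e₁ e₂
  have key := le_antisymm e₁ e₂
  rwa [Measure.map_prod_map _ _ measurable_fst measurable_fst,
    Measure.map_prod_map _ _ measurable_snd measurable_snd,
    lintegral_map h.graphex₁.isNonneg.measurable_enorm_W (by fun_prop),
    lintegral_map h.graphex₂.isNonneg.measurable_enorm_W (by fun_prop)] at key

/-- The kernel norm controls integrals over products of rectangles, and these determine a kernel. -/
theorem ae_W_eq : ∀ᵐ p ∂(κ.prod κ), 𝕎₁.W p.1.1 p.2.1 = 𝕎₂.W p.1.2 p.2.2 := by
  have hs₁ := h.graphex₁.sigmaFinite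
  have hs₂ := h.graphex₂.sigmaFinite
  have hsκ := h.sigmaFinite_limit
  have hn₁ := h.graphex₁.isNonneg
  have hn₂ := h.graphex₂.isNonneg
  let R : ℕ → Set (Ω₁ × Ω₂) := fun m => marginalSet 𝕎₁ μ₁ m ×ˢ marginalSet 𝕎₂ μ₂ m
  have hS := measurableSet_marginalSet (μ := μ₁) hn₁
  have hT := measurableSet_marginalSet (μ := μ₂) hn₂
  have hR : ∀ m, MeasurableSet (R m) := fun m => (hS m).prod (hT m)
  have hRm : Monotone R := fun m k hmk => prod_mono (marginalSet_mono hmk) (marginalSet_mono hmk)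
  have hRu : ⋃ m, R m = univ := by
    rw [iUnion_prod_of_monotone marginalSet_mono marginalSet_mono,
      iUnion_marginalSet h.marginal_pos₁, iUnion_marginalSet h.marginal_pos₂, univ_prod_univ]
  have hRu' : ⋃ m, R m ×ˢ R m = univ := by
    rw [iUnion_prod_of_monotone hRm hRm, hRu, univ_prod_univ]
  have hm₁ : Measurable fun p : (Ω₁ × Ω₂) × (Ω₁ × Ω₂) => ‖𝕎₁.W p.1.1 p.2.1‖ₑ :=
    (hn₁.pullback (measurable_fst (β := Ω₂))).measurable_enorm_W
  have hm₂ : Measurable fun p : (Ω₁ × Ω₂) × (Ω₁ × Ω₂) => ‖𝕎₂.W p.1.2 p.2.2‖ₑ :=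
    (hn₂.pullback (measurable_snd (α := Ω₁))).measurable_enorm_W
  rw [← Measure.restrict_univ (μ := κ.prod κ), ← hRu', ae_restrict_iUnion_iff]
  intro m
  have hfin : IsFiniteMeasure (κ.restrict (R m)) := ⟨by
    rw [Measure.restrict_apply_univ]
    refine (measure_mono (prod_subset_preimage_fst _ _)).trans_lt ?_
    rw [← Measure.map_apply measurable_fst (hS m), h.map_fst]
    exact h.measure_marginalSet_lt_top m⟩
  rw [← Measure.prod_restrict]
  set η := (κ.restrict (R m)).prod (κ.restrict (R m)) with hη
  have hint : ∫⁻ p, ‖𝕎₁.W p.1.1 p.2.1‖ₑ ∂η ≠ ∞ := by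
    refine (lt_of_le_of_lt (lintegral_mono (g := fun _ => 1) fun p => ?_) ?_).ne
    · rw [Real.enorm_of_nonneg (hn₁.W_nonneg _ _)]
      simpa using (h.graphex₁.W_mem p.1.1 p.2.1).2
    · simp
  have hfin' : IsFiniteMeasure (η.withDensity fun p => ‖𝕎₁.W p.1.1 p.2.1‖ₑ) :=
    isFiniteMeasure_withDensity hint
  -- `W₁` and `W₂` are densities of the same measure
  have heq : (η.withDensity fun p => ‖𝕎₁.W p.1.1 p.2.1‖ₑ) =
      η.withDensity fun p => ‖𝕎₂.W p.1.2 p.2.2‖ₑ := by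
    refine measure_ext_prod_prod fun A B A' B' hA hB hA' hB' => ?_
    have hAB := hA.prod hB
    have hAB' := hA'.prod hB'
    rw [withDensity_apply _ (hAB.prod hAB'), withDensity_apply _ (hAB.prod hAB'), hη,
      ← Measure.prod_restrict, Measure.restrict_restrict hAB, Measure.restrict_restrict hAB',
      prod_inter_prod, prod_inter_prod]
    exact h.lintegral_W_rect_eq m (hA.inter (hS m)) (hA'.inter (hS m)) (hB.inter (hT m))
      (hB'.inter (hT m)) inter_subset_right inter_subset_right inter_subset_right
      inter_subset_right
  have hae := (withDensity_eq_iff hm₁.aemeasurable hm₂.aemeasurable hint).1 heq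
  filter_upwards [hae] with p hp
  rw [Real.enorm_of_nonneg (hn₁.W_nonneg _ _), Real.enorm_of_nonneg (hn₂.W_nonneg _ _)] at hp
  exact (ENNReal.ofReal_eq_ofReal_iff (hn₁.W_nonneg _ _) (hn₂.W_nonneg _ _)).1 hp

/-- The full marginals and their `W`-parts agree, the latter being finite. -/
theorem ae_S_eq : ∀ᵐ p ∂κ, 𝕎₁.S p.1 = 𝕎₂.S p.2 := by
  have hsκ := h.sigmaFinite_limit
  have hn₁ := h.graphex₁.isNonneg
  have hn₂ := h.graphex₂.isNonneg
  have hfin : ∀ᵐ p ∂κ, Integrable (fun y => 𝕎₁.W y p.1) μ₁ := by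
    refine ae_of_ae_map (f := Prod.fst) (p := fun x => Integrable (fun y => 𝕎₁.W y x) μ₁)
      measurable_fst.aemeasurable ?_
    rw [h.map_fst]
    exact h.graphex₁.ae_integrable
  filter_upwards [hfin, Measure.ae_ae_of_ae_prod h.ae_W_eq, h.ae_absMarginal_eq] with p hp hW hD
  have e : ∫⁻ x, ‖𝕎₁.W p.1 x‖ₑ ∂μ₁ = ∫⁻ y, ‖𝕎₂.W p.2 y‖ₑ ∂μ₂ := by
    rw [← h.map_fst, ← h.map_snd,
      lintegral_map (f := fun x => ‖𝕎₁.W p.1 x‖ₑ)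
        (hn₁.measurable_W.comp (measurable_prodMk_left (x := p.1))).enorm measurable_fst,
      lintegral_map (f := fun x => ‖𝕎₂.W p.2 x‖ₑ)
        (hn₂.measurable_W.comp (measurable_prodMk_left (x := p.2))).enorm measurable_snd]
    refine lintegral_congr_ae ?_
    filter_upwards [hW] with q hq using by rw [hq]
  have hfin' : ∫⁻ x, ‖𝕎₁.W p.1 x‖ₑ ∂μ₁ ≠ ∞ := by
    simp_rw [hn₁.symm_W p.1]
    exact hp.2.ne
  rw [Triple.absMarginal, Triple.absMarginal, ← e, ENNReal.add_right_inj hfin',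
    Real.enorm_of_nonneg (hn₁.S_nonneg _), Real.enorm_of_nonneg (hn₂.S_nonneg _)] at hD
  exact (ENNReal.ofReal_eq_ofReal_iff (hn₁.S_nonneg _) (hn₂.S_nonneg _)).1 hD

/-! ### The dust parts agree -/

/-- The threshold `1` can be taken on both sides of the gap, since the marginals agree in the limit. -/
theorem tendsto_measure_gap_one : Tendsto (fun n =>
    ν n {z | 1 < liftMarginal 𝕎₂ μ₂ π₂ z ∧ liftMarginal 𝕎₁ μ₁ π₁ z ≤ 1}) l (𝓝 0) := by
  have hs₁ := h.graphex₁.sigmaFinite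
  have hs₂ := h.graphex₂.sigmaFinite
  have hn₁ := h.graphex₁.isNonneg
  have hn₂ := h.graphex₂.isNonneg
  have hS := measurableSet_marginalSet (μ := μ₁) hn₁ 0
  have hT := measurableSet_marginalSet (μ := μ₂) hn₂ 0
  have hTf := h.swap.measure_marginalSet_lt_top 0
  have hlim := h.tendsto_rect 0 _ _ hS hT le_rfl le_rfl
  -- the marginals agree in the limit, so that the rectangle carries all the mass of its second side
  have hκ : κ (marginalSet 𝕎₁ μ₁ 0 ×ˢ marginalSet 𝕎₂ μ₂ 0) = μ₂ (marginalSet 𝕎₂ μ₂ 0) := by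
    have e : κ (Prod.snd ⁻¹' marginalSet 𝕎₂ μ₂ 0) = μ₂ (marginalSet 𝕎₂ μ₂ 0) := by
      rw [← Measure.map_apply measurable_snd hT, h.map_snd]
    rw [← e]
    refine measure_congr ?_
    filter_upwards [h.ae_absMarginal_eq] with p hp
    refine propext ⟨fun hp' => hp'.2, fun hp' => ⟨?_, hp'⟩⟩
    rwa [marginalSet, mem_ofPred_eq, hp]
  rw [hκ] at hlim
  have hsub := ENNReal.Tendsto.sub (tendsto_const_nhds (x := μ₂ (marginalSet 𝕎₂ μ₂ 0)) (f := l))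
    hlim (Or.inl hTf.ne)
  rw [tsub_self] at hsub
  refine tendsto_of_tendsto_of_tendsto_of_le_of_le tendsto_const_nhds hsub
    (fun n => zero_le) fun n => ?_
  have hR := h.measurableSet_liftRect hS hT
  have hRf : ν n (liftRect π₁ π₂ (marginalSet 𝕎₁ μ₁ 0) (marginalSet 𝕎₂ μ₂ 0)) ≠ ∞ := by
    refine ((measure_mono inter_subset_right).trans_lt ?_).ne
    rw [(h.lift₂ n).measure_preimage hT]
    exact ((h.lift₂ n).near.le _).trans_lt hTf
  refine ENNReal.le_sub_of_add_le_right hRf ?_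
  rw [← measure_union _ hR]
  · refine le_trans ?_ ((h.lift₂ n).near.le (marginalSet 𝕎₂ μ₂ 0))
    rw [← (h.lift₂ n).measure_preimage hT]
    refine measure_mono ?_
    rintro z (⟨hz, -⟩ | hz)
    · rw [liftMarginal] at hz
      rcases hπ : π₂ z with y | t
      · rw [hπ] at hz
        rw [mem_preimage, hπ, marginalSet_zero]
        exact ⟨y, hz, rfl⟩
      · simp [hπ] at hz
    · exact hz.2
  · refine Set.disjoint_left.2 fun z hz hz' => ?_
    obtain ⟨⟨x, hx, hxz⟩, -⟩ := hz'
    have := hz.2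
    rw [liftMarginal, ← hxz] at this
    rw [marginalSet_zero] at hx
    exact not_lt.2 this hx

theorem norm1_restrict_lt_top :
    𝕎₁.norm1 (μ₁.restrict {x | 𝕎₁.absMarginal μ₁ x ≤ 1}) < ∞ := by
  have := h.neBot
  have hs₁ := h.graphex₁.sigmaFinite
  obtain ⟨n, hn⟩ := (h.tendsto_zero.eventually (gt_mem_nhds ENNReal.zero_lt_top)).exists
  have : SigmaFinite (μ₁' n) := Measure.sigmaFinite_of_le μ₁ (h.lift₁ n).near.le
  refine (norm1_restrict_le_of_near h.graphex₁.isNonneg (h.lift₁ n).near).trans_lt ?_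
  have := (𝕎₁.norm1_mono (Measure.restrict_le_self (μ := μ₁' n)
    (s := {x | 𝕎₁.absMarginal μ₁ x ≤ 1}))).trans_lt (h.lift₁ n).norm1_lt_top
  finiteness

/-- In the limit, the total masses off the points of marginal greater than `1` agree. Removing these
points makes the masses finite, even if those of the triples are not. -/
theorem norm1_restrict_le : 𝕎₁.norm1 (μ₁.restrict {x | 𝕎₁.absMarginal μ₁ x ≤ 1}) ≤
    𝕎₂.norm1 (μ₂.restrict {x | 𝕎₂.absMarginal μ₂ x ≤ 1}) := by
  have := h.neBot
  have hs₁ := h.graphex₁.sigmaFinite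
  have hs₂ := h.graphex₂.sigmaFinite
  have hsν := h.sigmaFinite
  set C := μ₂ {x | 1 < 𝕎₂.absMarginal μ₂ x} with hC
  have hCf : C < ∞ := h.swap.measure_lt_absMarginal_lt_top zero_lt_one
  have hC' : C ^ (1 / 2 : ℝ) ≠ ∞ := ENNReal.rpow_ne_top_of_nonneg (by norm_num) hCf.ne
  have h0 := h.tendsto_zero
  have h2 : Tendsto (fun n => ε n ^ 2) l (𝓝 0) := by simpa using ENNReal.Tendsto.pow h0 (n := 2)
  have h3 : Tendsto (fun n => ε n ^ 3) l (𝓝 0) := by simpa using ENNReal.Tendsto.pow h0 (n := 3)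
  have h4 : Tendsto (fun n => 4 * ε n ^ 2) l (𝓝 0) := by
    simpa using ENNReal.Tendsto.const_mul h2 (Or.inr (show (4 : ℝ≥0∞) ≠ ∞ by norm_num))
  have hεC : Tendsto (fun n => ε n * C) l (𝓝 0) := by
    simpa using ENNReal.Tendsto.mul_const h0 (Or.inr hCf.ne)
  have hsq : Tendsto (fun n => ε n ^ 2 * C ^ (1 / 2 : ℝ)) l (𝓝 0) := by
    simpa using ENNReal.Tendsto.mul_const h2 (Or.inr hC')
  have hdbl : ∀ {u : ℕ → ℝ≥0∞}, Tendsto u l (𝓝 0) → Tendsto (fun n => 2 * u n) l (𝓝 0) := by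
    intro u hu
    simpa using ENNReal.Tendsto.const_mul hu (Or.inr (show (2 : ℝ≥0∞) ≠ ∞ by norm_num))
  have hgap : Tendsto (fun n => ν n {z | 1 < liftMarginal 𝕎₂ μ₂ π₂ z ∧
      liftMarginal 𝕎₁ μ₁ π₁ z ≤ 1} + ε n ^ 2 * C ^ (1 / 2 : ℝ)) l (𝓝 0) := by
    simpa only [add_zero] using h.tendsto_measure_gap_one.add hsq
  have herr := (h4.add ((h3.add hεC).add (hdbl hsq))).add (hdbl hgap)
  have hlim := herr.const_add (𝕎₂.norm1 (μ₂.restrict {x | 𝕎₂.absMarginal μ₂ x ≤ 1}))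
  simp only [add_zero] at hlim
  refine ge_of_tendsto' hlim fun n => ?_
  exact norm1_restrict_le_of_isClose h.graphex₁.isNonneg
    h.graphex₂.isNonneg (h.lift₁ n) (h.lift₂ n) (h.close₁₂ n) (h.close₂₁ n) hC.ge hCf

/-- After removal of the points of marginal greater than `1`, the total mass is finite and its `W`- and
`S`-parts agree under the coupling, so the dust parts agree too. -/
theorem I_eq : 𝕎₁.I = 𝕎₂.I := by
  have hs₁ := h.graphex₁.sigmaFinite
  have hs₂ := h.graphex₂.sigmaFinite
  have hsκ := h.sigmaFinite_limit
  have hn₁ := h.graphex₁.isNonneg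
  have hn₂ := h.graphex₂.isNonneg
  have heq := le_antisymm h.norm1_restrict_le h.swap.norm1_restrict_le
  have hfin := h.norm1_restrict_lt_top
  have hA₁ : MeasurableSet {x | 𝕎₁.absMarginal μ₁ x ≤ 1} :=
    measurableSet_le (hn₁.measurable_absMarginal μ₁) measurable_const
  have hA₂ : MeasurableSet {x | 𝕎₂.absMarginal μ₂ x ≤ 1} :=
    measurableSet_le (hn₂.measurable_absMarginal μ₂) measurable_const
  set K := κ.restrict (Prod.fst ⁻¹' {x | 𝕎₁.absMarginal μ₁ x ≤ 1}) with hK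
  have hK' : K = κ.restrict (Prod.snd ⁻¹' {x | 𝕎₂.absMarginal μ₂ x ≤ 1}) := by
    refine Measure.restrict_congr_set ?_
    filter_upwards [h.ae_absMarginal_eq] with p hp
    refine propext ?_
    change 𝕎₁.absMarginal μ₁ p.1 ≤ 1 ↔ 𝕎₂.absMarginal μ₂ p.2 ≤ 1
    rw [hp]
  have e₁ : (𝕎₁.pullback Prod.fst).norm1 K =
      𝕎₁.norm1 (μ₁.restrict {x | 𝕎₁.absMarginal μ₁ x ≤ 1}) := by
    rw [hn₁.norm1_pullback measurable_fst, hK, ← Measure.restrict_map measurable_fst hA₁,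
      h.map_fst]
  have e₂ : (𝕎₂.pullback Prod.snd).norm1 K =
      𝕎₂.norm1 (μ₂.restrict {x | 𝕎₂.absMarginal μ₂ x ≤ 1}) := by
    rw [hn₂.norm1_pullback measurable_snd, hK', ← Measure.restrict_map measurable_snd hA₂,
      h.map_snd]
  rw [← e₁] at hfin
  rw [← e₁, ← e₂] at heq
  have hW : ∫⁻ p, ‖(𝕎₁.pullback Prod.fst).W p.1 p.2‖ₑ ∂(K.prod K) =
      ∫⁻ p, ‖(𝕎₂.pullback Prod.snd).W p.1 p.2‖ₑ ∂(K.prod K) := by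
    refine lintegral_congr_ae ?_
    rw [hK, Measure.prod_restrict]
    filter_upwards [ae_restrict_of_ae h.ae_W_eq] with p hp
    exact congrArg enorm hp
  have hS : ∫⁻ p, ‖(𝕎₁.pullback Prod.fst).S p‖ₑ ∂K =
      ∫⁻ p, ‖(𝕎₂.pullback Prod.snd).S p‖ₑ ∂K := by
    refine lintegral_congr_ae ?_
    filter_upwards [ae_restrict_of_ae h.ae_S_eq] with p hp
    exact congrArg enorm hp
  rw [Triple.norm1] at hfin
  rw [Triple.norm1, Triple.norm1, ← hW, ← hS,
    ENNReal.add_right_inj (ne_top_of_le_ne_top hfin.ne le_self_add),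
    ENNReal.mul_right_inj (by norm_num) (by norm_num)] at heq
  change ‖𝕎₁.I‖ₑ = ‖𝕎₂.I‖ₑ at heq
  rw [Real.enorm_of_nonneg hn₁.I_nonneg, Real.enorm_of_nonneg hn₂.I_nonneg] at heq
  exact (ENNReal.ofReal_eq_ofReal_iff hn₁.I_nonneg hn₂.I_nonneg).1 heq

end IsCouplingLimit

/-! ### Existence of a limit -/

/-- Near-optimal submeasures and couplings for the weak kernel distance have a limit along any
nonprincipal ultrafilter. -/
theorem exists_isCouplingLimit {Ω₁ Ω₂ : Type*}
    [MeasurableSpace Ω₁] [StandardBorelSpace Ω₁] [MeasurableSpace Ω₂] [StandardBorelSpace Ω₂]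
    {μ₁ : Measure Ω₁} {μ₂ : Measure Ω₂} {𝕎₁ : Triple Ω₁} {𝕎₂ : Triple Ω₂}
    (h₁ : IsGraphex 𝕎₁ μ₁) (h₂ : IsGraphex 𝕎₂ μ₂)
    (hD₁ : ∀ x, 0 < 𝕎₁.absMarginal μ₁ x) (hD₂ : ∀ x, 0 < 𝕎₂.absMarginal μ₂ x)
    (hδ : weakKernelDist 𝕎₁ μ₁ 𝕎₂ μ₂ = 0) :
    ∃ (μ₁' : ℕ → Measure Ω₁) (μ₂' : ℕ → Measure Ω₂)
      (ν : ℕ → Measure ((Ω₁ ⊕ ℝ) × (Ω₂ ⊕ ℝ))) (ε : ℕ → ℝ≥0∞) (l : Filter ℕ)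
      (κ : Measure (Ω₁ × Ω₂)),
      IsCouplingLimit 𝕎₁ μ₁ 𝕎₂ μ₂ μ₁' μ₂' ν Prod.fst Prod.snd ε l κ := by
  have hs₁ := h₁.sigmaFinite
  have hs₂ := h₂.sigmaFinite
  choose μ₁' μ₂' ν hν l₁ l₂ c₁ c₂ using fun n : ℕ =>
    exists_isLift_isClose h₁ h₂ hδ (ε := (n : ℝ≥0∞)⁻¹) (by simp)
  have hε : Tendsto (fun n : ℕ => (n : ℝ≥0∞)⁻¹) (hyperfilter ℕ) (𝓝 0) :=
    ENNReal.tendsto_inv_nat_nhds_zero.mono_left Nat.hyperfilter_le_atTop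
  have hf₁ : ∀ m, μ₁ (marginalSet 𝕎₁ μ₁ m) < ∞ := fun m =>
    h₁.measure_lt_absMarginal_lt_top l₁ hε (by simp)
  have hf₂ : ∀ m, μ₂ (marginalSet 𝕎₂ μ₂ m) < ∞ := fun m =>
    h₂.measure_lt_absMarginal_lt_top l₂ hε (by simp)
  let e : Ω₁ × Ω₂ → (Ω₁ ⊕ ℝ) × (Ω₂ ⊕ ℝ) := Prod.map Sum.inl Sum.inl
  have he : MeasurableEmbedding e := measurableEmbedding_inl.prodMap measurableEmbedding_inl
  obtain ⟨κ, hκ⟩ := exists_tendsto_measure_prod (hyperfilter ℕ) μ₁ μ₂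
    (measurableSet_marginalSet h₁.isNonneg) (measurableSet_marginalSet h₂.isNonneg) hf₁ hf₂
    (fun n => (ν n).comap e)
    (fun n => by
      refine Measure.le_iff.2 fun A hA => ?_
      rw [Measure.map_apply measurable_fst hA, he.comap_apply]
      refine le_trans ?_ ((l₁ n).near.le A)
      rw [← (l₁ n).measure_preimage hA]
      refine measure_mono ?_
      rintro _ ⟨p, hp, rfl⟩
      exact ⟨p.1, hp, rfl⟩)
    (fun n => by
      refine Measure.le_iff.2 fun A hA => ?_
      rw [Measure.map_apply measurable_snd hA, he.comap_apply]
      refine le_trans ?_ ((l₂ n).near.le A)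
      rw [← (l₂ n).measure_preimage hA]
      refine measure_mono ?_
      rintro _ ⟨p, hp, rfl⟩
      exact ⟨p.2, hp, rfl⟩)
  refine ⟨μ₁', μ₂', ν, fun n => (n : ℝ≥0∞)⁻¹, hyperfilter ℕ, κ, h₁, h₂, hD₁, hD₂, inferInstance,
    hε, hν, l₁, l₂, c₁, c₂, fun m A B hA hB hAm hBm => ?_⟩
  refine (hκ m A B hA hB hAm hBm).congr fun n => ?_
  rw [he.comap_apply, prodMap_image_prod]
  rfl

end Graphex

end

theorem mainTheorem9 {Ω₁ Ω₂ : Type*}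
    [MeasurableSpace Ω₁] [StandardBorelSpace Ω₁] [MeasurableSpace Ω₂] [StandardBorelSpace Ω₂]
    (μ₁ : Measure Ω₁) (μ₂ : Measure Ω₂)
    (𝕎₁ : Graphex.Triple Ω₁) (𝕎₂ : Graphex.Triple Ω₂)
    (h₁ : Graphex.IsGraphex 𝕎₁ μ₁) (h₂ : Graphex.IsGraphex 𝕎₂ μ₂)
    (hD₁ : ∀ x, 0 < 𝕎₁.absMarginal μ₁ x) (hD₂ : ∀ x, 0 < 𝕎₂.absMarginal μ₂ x)
    (hδ : Graphex.weakKernelDist 𝕎₁ μ₁ 𝕎₂ μ₂ = 0) :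
    μ₁ Set.univ = μ₂ Set.univ ∧ 𝕎₁.I = 𝕎₂.I ∧
    ∃ ν : Measure (Ω₁ × Ω₂), Graphex.IsCoupling ν μ₁ μ₂ ∧
      (∀ᵐ p ∂(ν.prod ν),
        (𝕎₁.pullback Prod.fst).W p.1 p.2 = (𝕎₂.pullback Prod.snd).W p.1 p.2) ∧
      (∀ᵐ x ∂ν, (𝕎₁.pullback Prod.fst).S x = (𝕎₂.pullback Prod.snd).S x) := by
  obtain ⟨_, _, _, _, _, κ, hκ⟩ := Graphex.exists_isCouplingLimit h₁ h₂ hD₁ hD₂ hδ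
  refine ⟨?_, hκ.I_eq, κ, ⟨hκ.map_fst, hκ.map_snd⟩, hκ.ae_W_eq, hκ.ae_S_eq⟩
  rw [← hκ.map_fst, ← hκ.map_snd, Measure.map_apply measurable_fst .univ,
    Measure.map_apply measurable_snd .univ, Set.preimage_univ, Set.preimage_univ]
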